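/- Let $d\ge 0$ and let $F=\{F(t):t\in\mathbb Z^d\}$ be a stochastic process with values in $[0,\infty)$ such that $\sum_{t\in\mathbb Z^d}\mathbb E F(t)=1$ and such that, for some constant $\lambda>0$, almost surely $F(0)=\lambda$ and $F(t)<\lambda$ for all $t\in\mathbb Z^d\setminus\{0\}$. Let $\sum_{i\in\mathbb N}\delta_{(U_i,T_i,F_i)}$ be a Poisson point process on $(0,\infty)\times\mathbb Z^d\times[0,\infty)^{\mathbb Z^d}$ with intensity $u^{-2}\,du\times(\text{counting measure})(dt)\times\mathbb P_F(df)$, where $\mathbb P_F$ is the law of $F$, and let $$M(t)=\max_{i\in\mathbb N}U_iF_i(t-T_i),\qquad t\in\mathbb Z^d .$$ Let $\eta=\{\eta(t):t\in\mathbb Z^d\}$ be a real-valued process in the max-domain of attraction of $M$ in the following sense: if $\eta_1,\eta_2,\dots$ are independent copies of $\eta$, then $\frac1n\max_{1\le i\le n}\eta_i(\cdot)$ converges to $M$ in the sense of finite-dimensional distributions as $n\to\infty$. Let $k\in\mathbb N$ (with $k=0$ allowed), let $t_0,\dots,t_k\in\mathbb Z^d$ be distinct points, let $B_1,\dots,B_k\subset[0,\infty)$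 be Borel sets with $$\mathbb P\big\{(F(t_1)/\lambda,\dots,F(t_k)/\lambda)\in\partial(B_1\times\cdots\times B_k)\big\}=0,$$ where the boundary is taken in $\mathbb R^k$ or, if $\eta(t)\ge0$ almost surely for every $t$, alternatively in $[0,\infty)^k$, and let $a(n)$ be a real sequence with $a(n)\to\infty$. For finite $L\subset\mathbb Z^d$ with $0\in L$ let $$A_{n,L}=\Big\{\eta(t_0)=\max_{t\in L}\eta(t_0+t),\ \eta(t_0)\ge a(n)\Big\}.$$ Then for every such $L$ one has $\mathbb P(A_{n,L})>0$ for all sufficiently large $n$, and $$\lim_{L\nearrow\mathbb Z^d}\ \limsup_{n\to\infty}\ \mathbb P\big\{\eta(t_0+t_i)/\eta(t_0)\in B_i,\ i=1,\dots,k\,\big|\,A_{n,L}\big\}=\mathbb P\big\{F(t_i)/\lambda\in B_i,\ i=1,\dots,k\big\},$$ and the same holds with $\limsup_{n\to\infty}$ replaced by $\liminf_{n\to\infty}$. Here $\lim_{L\nearrow\mathbb Z^d}$ is the limit along the finite subsets of $\mathbb Z^d$ directed by inclusion. -/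

import Mathlib

open Set Filter Topology MeasureTheory ProbabilityTheory
open scoped NNReal ENNReal

/-- The random counting measure `∑ i, δ_{X i}` of a sequence `X` of random points of `S`. -/
noncomputable def pointMeasure {S Ω : Type*} [MeasurableSpace S] (X : ℕ → Ω → S) (ω : Ω) :
    Measure S :=
  Measure.sum fun i => Measure.dirac (X i ω)

/-- `∑ i, δ_{X i}` is a Poisson point process on `S` with intensity measure `ν`: the number of
points in a measurable set `A` is Poisson distributed with mean `ν A` (and almost surely infinite
if `ν A = ∞`), and the numbers of points in disjoint measurable sets are independent. -/
structure IsPoissonPointProcess {S Ω : Type*} [MeasurableSpace S] [MeasurableSpace Ω]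
    (X : ℕ → Ω → S) (ν : Measure S) (P : Measure Ω) : Prop where
  measurable : ∀ i, Measurable (X i)
  law : ∀ A : Set S, MeasurableSet A → ν A ≠ ∞ →
    HasLaw (fun ω => pointMeasure X ω A)
      ((poissonMeasure (ν A).toNNReal).map (fun m : ℕ => (m : ℝ≥0∞))) P
  eq_top : ∀ A : Set S, MeasurableSet A → ν A = ∞ → ∀ᵐ ω ∂P, pointMeasure X ω A = ∞
  indep : ∀ (m : ℕ) (A : Fin m → Set S), (∀ j, MeasurableSet (A j)) →
    Pairwise (fun i j => Disjoint (A i) (A j)) →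
    iIndepFun (fun j ω => pointMeasure X ω (A j)) P

/-- The measure `u⁻² du` on `(0, ∞)`, as a measure on `ℝ` carried by `(0, ∞)`. -/
noncomputable def frechetIntensity : Measure ℝ :=
  (volume.restrict (Ioi (0 : ℝ))).withDensity fun u => ENNReal.ofReal (u ^ 2)⁻¹

/-- The measure `u⁻² du × (counting measure)(dt) × P_F(df)` on
`(0, ∞) × ℤ^d × [0, ∞)^{ℤ^d}`, where `P_F` is the law of the random function `F`. -/
noncomputable def discreteM3Intensity {d : ℕ} {Ω : Type*} [MeasurableSpace Ω]
    (F : (Fin d → ℤ) → Ω → ℝ≥0) (P : Measure Ω) :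
    Measure (ℝ × (Fin d → ℤ) × ((Fin d → ℤ) → ℝ≥0)) :=
  frechetIntensity.prod
    ((Measure.count : Measure (Fin d → ℤ)).prod (P.map fun ω t => F t ω))

/-- The process `M(t) = max_i U_i F_i(t - T_i)`, `t ∈ ℤ^d`, built from the random points
`X i = (U_i, T_i, F_i)`. -/
noncomputable def discreteM3 {d : ℕ} {Ω : Type*}
    (X : ℕ → Ω → ℝ × (Fin d → ℤ) × ((Fin d → ℤ) → ℝ≥0)) (t : Fin d → ℤ) (ω : Ω) : ℝ :=
  ⨆ i, (X i ω).1 * ((X i ω).2.2 (t - (X i ω).2.1) : ℝ)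

/-- `η` is in the max-domain of attraction of `ξ` with norming functions `c` and `b`, in the sense
of finite-dimensional distributions: with independent copies `η_1, η_2, …` of `η` (realised on the
infinite product space), `c_n(t) (max_{i ≤ n} η_i(t) - b_n(t))` converges to `ξ(t)`. -/
def InMDA {T Ω Ω' : Type*} [MeasurableSpace Ω] [MeasurableSpace Ω']
    (η : T → Ω → ℝ) (P : Measure Ω) [IsProbabilityMeasure P]
    (ξ : T → Ω' → ℝ) (P' : Measure Ω') [IsProbabilityMeasure P'] (c b : ℕ → T → ℝ) : Prop :=
  ∀ (m : ℕ) (s : Fin m → T),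
    TendstoInDistribution
      (fun (n : ℕ) (w : ℕ → Ω) (j : Fin m) => c n (s j) * ((⨆ i : Fin n, η (s j) (w i)) - b n (s j)))
      atTop (fun ω j => ξ (s j) ω) (fun _ => Measure.infinitePi fun _ : ℕ => P) P'

/-- The event that `η(t₀)` is the maximum of `η` over `t₀ + L` and is at least `a`. -/
def localMaxEvent {d : ℕ} {Ω : Type*} (η : (Fin d → ℤ) → Ω → ℝ) (t₀ : Fin d → ℤ)
    (L : Finset (Fin d → ℤ)) (a : ℝ) : Set Ω :=
  {ω | IsGreatest ((fun t => η (t₀ + t) ω) '' (L : Set (Fin d → ℤ))) (η t₀ ω) ∧ a ≤ η t₀ ω}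

/-- The event that `η(t₀ + t_i) / η(t₀) ∈ B_i` for all `i`. -/
def ratioEvent {d k : ℕ} {Ω : Type*} (η : (Fin d → ℤ) → Ω → ℝ) (t₀ : Fin d → ℤ)
    (t : Fin k → Fin d → ℤ) (B : Fin k → Set ℝ≥0) : Set Ω :=
  {ω | ∀ i, η (t₀ + t i) ω / η t₀ ω ∈ ((↑) : ℝ≥0 → ℝ) '' B i}

/-! For positive levels `x j`, let `V` be the intensity of the points `(u, t, f)` that exceed level
`x j` at some site `s j`. It is finite because the margins have total mass `∑ E F = 1`, and the void
probability of the Poisson process gives `P(M(s j) ≤ x j for all j) = exp(-V)`. The max-domain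
assumption says that the `n`-th power of `P(η(s j) ≤ n x j for all j)` tends to this value. Taking
logarithms turns it into a tail asymptotic: `a * P(η(s j) > a x j for some j)` tends to `V`, first
along integers and then, by monotonicity, along all real `a → ∞` (`tendsto_mul_measureReal_exceed`).
Differences of such tails identify the weak limit of `(η / a)⁺` given `η(s₀) > a`: it is the law of
the contributions of one Poisson point whose contribution at `s₀` exceeds `1`
(`tendsto_conditionalLaw`).

Under this limit law, suppose that `s₀` is a maximum over `s₀ + L`. The contribution of a point
located at `t` has its strict maximum at `t`, so either `t = s₀` or `t` lies outside `s₀ + L`.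
Points at `s₀` have ratios `F / λ`, and `u λ > 1` has mass `λ`, so they contribute `λ P(F / λ ∈ ·)`.
Points outside `s₀ + L` contribute at most the tail of `∑ E F`, which vanishes as `L` grows. The
portmanteau theorem, with an open set from below and a closed set from above, transfers this to `η`.
Dividing the estimate for the ratio event by the one for the whole space cancels `λ` and leaves two
bounds, both tending to `P(F / λ ∈ B)`. -/

/-! ### Intensity of exceedance sets -/

/-- The value `u * f (s - t)` at the site `s` of the moving maxima contribution of the point
`p = (u, t, f)`. -/
def contribution {d : ℕ} (s : Fin d → ℤ) (p : ℝ × (Fin d → ℤ) × ((Fin d → ℤ) → ℝ≥0)) : ℝ :=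
  p.1 * (p.2.2 (s - p.2.1) : ℝ)

/-- The points `(u, t, f)` whose contribution exceeds the level `x j` at some site `s j`. -/
def exceedance {d : ℕ} {ι : Type*} (s : ι → Fin d → ℤ) (x : ι → ℝ) :
    Set (ℝ × (Fin d → ℤ) × ((Fin d → ℤ) → ℝ≥0)) :=
  {p | ∃ j, x j < contribution (s j) p}

/-- The evaluation site varies over a countable set, so measurability can be checked with the site
fixed. -/
lemma measurable_eval_sub {d : ℕ} (s : Fin d → ℤ) :
    Measurable fun q : (Fin d → ℤ) × ((Fin d → ℤ) → ℝ≥0) => q.2 (s - q.1) :=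
  measurable_from_prod_countable_right fun t => measurable_pi_apply (s - t)

lemma measurable_contribution {d : ℕ} (s : Fin d → ℤ) : Measurable (contribution s) := by
  exact measurable_fst.mul
    (((measurable_eval_sub s).comp measurable_snd).coe_nnreal_real)

lemma measurableSet_exceedance {d : ℕ} {ι : Type*} [Countable ι] (s : ι → Fin d → ℤ)
    (x : ι → ℝ) : MeasurableSet (exceedance s x) := by
  have : exceedance s x = ⋃ j, {p | x j < contribution (s j) p} := by
    ext p; simp [exceedance]
  rw [this]
  exact .iUnion fun j => measurableSet_lt measurable_const (measurable_contribution _)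

lemma frechetIntensity_Ioi {r : ℝ} (hr : 0 < r) :
    frechetIntensity (Ioi r) = ENNReal.ofReal r⁻¹ := by
  have hint := integrableOn_Ioi_rpow_of_lt (a := -2) (by norm_num) hr
  have hval := integral_Ioi_rpow_of_lt (a := -2) (by norm_num) hr
  rw [frechetIntensity, withDensity_apply _ measurableSet_Ioi, Measure.restrict_restrict
    measurableSet_Ioi, inter_eq_left.2 (Ioi_subset_Ioi hr.le)]
  have hcongr : ∫⁻ u in Ioi r, ENNReal.ofReal (u ^ 2)⁻¹
      = ∫⁻ u in Ioi r, ENNReal.ofReal (u ^ (-2 : ℝ)) := by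
    refine setLIntegral_congr_fun measurableSet_Ioi fun u hu => ?_
    have hu0 : (0 : ℝ) ≤ u := hr.le.trans (le_of_lt hu)
    simp only [Real.rpow_neg hu0, Real.rpow_two]
  rw [hcongr, ← ofReal_integral_eq_lintegral_ofReal hint, hval]
  · congr 1
    norm_num [Real.rpow_neg_one]
  · refine (ae_restrict_iff' measurableSet_Ioi).2 (ae_of_all _ fun u hu => ?_)
    exact Real.rpow_nonneg (hr.le.trans (le_of_lt hu)) _

lemma frechetIntensity_lt_mul {x : ℝ} (hx : 0 < x) (g : ℝ≥0) :
    frechetIntensity {u : ℝ | x < u * g} = g / ENNReal.ofReal x := by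
  rcases eq_or_ne g 0 with rfl | hg
  · simp [hx.not_gt]
  have hg' : (0 : ℝ) < g := by exact_mod_cast pos_iff_ne_zero.2 hg
  have : {u : ℝ | x < u * g} = Ioi (x / g) := by
    ext u; simp [div_lt_iff₀ hg']
  rw [this, frechetIntensity_Ioi (by positivity), inv_div, ENNReal.ofReal_div_of_pos hx,
    ENNReal.ofReal_coe_nnreal]

instance : SFinite frechetIntensity := by unfold frechetIntensity; infer_instance

lemma discreteM3Intensity_apply {d : ℕ} {Ω : Type*} [MeasurableSpace Ω]
    {F : (Fin d → ℤ) → Ω → ℝ≥0} (hF : ∀ t, Measurable (F t)) (P : Measure Ω) [SFinite P]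
    {A : Set (ℝ × (Fin d → ℤ) × ((Fin d → ℤ) → ℝ≥0))} (hA : MeasurableSet A) :
    discreteM3Intensity F P A
      = ∑' t, ∫⁻ ω, frechetIntensity {u | (u, t, fun s => F s ω) ∈ A} ∂P := by
  have hm : Measurable fun q : (Fin d → ℤ) × ((Fin d → ℤ) → ℝ≥0) =>
      frechetIntensity ((fun u => (u, q)) ⁻¹' A) := measurable_measure_prodMk_right hA
  rw [discreteM3Intensity, Measure.prod_apply_symm hA, lintegral_prod _ hm.aemeasurable,
    lintegral_count]
  refine tsum_congr fun t => ?_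
  exact lintegral_map (hm.comp measurable_prodMk_left) (measurable_pi_lambda _ hF)

/-- A point located at `t` contributes mass `E F(s - t) / x`, and summing over `t` uses the
normalisation `∑ E F = 1`. This makes the margins of `M` unit Fréchet. -/
lemma discreteM3Intensity_lt_contribution {d : ℕ} {Ω : Type*} [MeasurableSpace Ω]
    {F : (Fin d → ℤ) → Ω → ℝ≥0} (hF : ∀ t, Measurable (F t)) (P : Measure Ω) [SFinite P]
    (hsum : ∑' t, ∫⁻ ω, (F t ω : ℝ≥0∞) ∂P = 1) (s : Fin d → ℤ) {x : ℝ} (hx : 0 < x) :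
    discreteM3Intensity F P {p | x < contribution s p} = (ENNReal.ofReal x)⁻¹ := by
  rw [discreteM3Intensity_apply hF P
    (measurableSet_lt measurable_const (measurable_contribution s))]
  simp only [mem_ofPred_eq, contribution, frechetIntensity_lt_mul hx, div_eq_mul_inv]
  have : ∀ t, ∫⁻ ω, (F (s - t) ω : ℝ≥0∞) * (ENNReal.ofReal x)⁻¹ ∂P
      = (∫⁻ ω, (F (s - t) ω : ℝ≥0∞) ∂P) * (ENNReal.ofReal x)⁻¹ := fun t =>
    lintegral_mul_const _ (hF _).coe_nnreal_ennreal
  simp only [this]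
  have hshift := (Equiv.subLeft s).tsum_eq fun t => ∫⁻ ω, (F t ω : ℝ≥0∞) ∂P
  simp only [Equiv.subLeft_apply] at hshift
  rw [ENNReal.tsum_mul_right, hshift, hsum, one_mul]

lemma discreteM3Intensity_exceedance_ne_top {d : ℕ} {Ω : Type*} [MeasurableSpace Ω]
    {F : (Fin d → ℤ) → Ω → ℝ≥0} (hF : ∀ t, Measurable (F t)) (P : Measure Ω) [SFinite P]
    (hsum : ∑' t, ∫⁻ ω, (F t ω : ℝ≥0∞) ∂P = 1) {ι : Type*} [Fintype ι] (s : ι → Fin d → ℤ)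
    {x : ι → ℝ} (hx : ∀ j, 0 < x j) :
    discreteM3Intensity F P (exceedance s x) ≠ ∞ := by
  have h1 : exceedance s x = ⋃ j, {p | x j < contribution (s j) p} := by
    ext p; simp [exceedance]
  rw [h1]
  refine ne_top_of_le_ne_top ?_ (measure_iUnion_fintype_le _ _)
  simp only [discreteM3Intensity_lt_contribution hF P hsum _ (hx _)]
  exact ENNReal.sum_ne_top.2 fun j _ => by simp [hx j]

/-! ### Void probabilities and the distribution functions of `M` -/

lemma IsPoissonPointProcess.measure_forall_notMem {S Ω : Type*} [MeasurableSpace S]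
    [MeasurableSpace Ω] {X : ℕ → Ω → S} {ν : Measure S} {P : Measure Ω}
    (hX : IsPoissonPointProcess X ν P) {A : Set S} (hA : MeasurableSet A) (hνA : ν A ≠ ∞) :
    P {ω | ∀ i, X i ω ∉ A} = ENNReal.ofReal (Real.exp (-(ν A).toReal)) := by
  have h0 : {ω | ∀ i, X i ω ∉ A} = {ω | pointMeasure X ω A = 0} := by
    ext ω
    simp [pointMeasure, Measure.sum_apply _ hA, hA]
  rw [h0, (hX.law A hA hνA).measure_eq (p := fun m => m = 0) (measurableSet_singleton _),
    Measure.map_apply (by fun_prop) (measurableSet_eq_fun (by fun_prop) (by fun_prop))]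
  have : (fun m : ℕ => (m : ℝ≥0∞)) ⁻¹' {x | x = 0} = {0} := by ext; simp
  rw [this, poissonMeasure_singleton]
  simp [ENNReal.coe_toNNReal_eq_toReal]

lemma forall_notMem_exceedance_iff {d : ℕ} {Ω : Type*}
    (X : ℕ → Ω → ℝ × (Fin d → ℤ) × ((Fin d → ℤ) → ℝ≥0)) (ω : Ω) {ι : Type*}
    (s : ι → Fin d → ℤ) (x : ι → ℝ)
    (hb : ∀ j, BddAbove (range fun i => contribution (s j) (X i ω))) :
    (∀ i, X i ω ∉ exceedance s x) ↔ ∀ j, discreteM3 X (s j) ω ≤ x j := by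
  simp only [exceedance, mem_ofPred_eq, not_exists, not_lt]
  rw [forall_comm]
  exact forall_congr' fun j => (ciSup_le_iff (hb j)).symm

/-- A real supremum over an unbounded family takes the default value `0`, so bounds on `discreteM3`
carry information about the points only where the family is bounded. Unboundedness forces a point
above every level `n + 1`, an event of probability `1 - exp(-1/(n+1))`. -/
lemma ae_bddAbove_contribution {d : ℕ} {Ω Ω' : Type*} [MeasurableSpace Ω] [MeasurableSpace Ω']
    {F : (Fin d → ℤ) → Ω → ℝ≥0} (hF : ∀ t, Measurable (F t)) (P : Measure Ω) [SFinite P]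
    (hsum : ∑' t, ∫⁻ ω, (F t ω : ℝ≥0∞) ∂P = 1)
    {X : ℕ → Ω' → ℝ × (Fin d → ℤ) × ((Fin d → ℤ) → ℝ≥0)} {P' : Measure Ω'}
    [IsProbabilityMeasure P'] (hX : IsPoissonPointProcess X (discreteM3Intensity F P) P')
    (s : Fin d → ℤ) :
    ∀ᵐ ω ∂P', BddAbove (range fun i => contribution s (X i ω)) := by
  have hm : ∀ x : ℝ, MeasurableSet {p | x < contribution s p} := fun x =>
    measurableSet_lt measurable_const (measurable_contribution s)
  have key : ∀ n : ℕ, P' {ω | ¬ BddAbove (range fun i => contribution s (X i ω))}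
      ≤ 1 - ENNReal.ofReal (Real.exp (-(n + 1 : ℝ)⁻¹)) := by
    intro n
    have hpos : (0 : ℝ) < n + 1 := by positivity
    have h1 := hX.measure_forall_notMem (hm (n + 1))
      (by rw [discreteM3Intensity_lt_contribution hF P hsum s hpos]; simp [hpos])
    rw [discreteM3Intensity_lt_contribution hF P hsum s hpos, ENNReal.toReal_inv,
      ENNReal.toReal_ofReal hpos.le] at h1
    have hmeas : MeasurableSet {ω | ∀ i, X i ω ∉ {p | (n + 1 : ℝ) < contribution s p}} := by
      simp only [ofPred_forall]
      exact .iInter fun i => ((hX.measurable i) (hm _)).compl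
    rw [← h1, ← prob_compl_eq_one_sub hmeas]
    refine measure_mono fun ω hω hcon => hω ⟨n + 1, ?_⟩
    rintro _ ⟨i, rfl⟩
    exact not_lt.1 (hcon i)
  have hlim : Tendsto (fun n : ℕ => 1 - ENNReal.ofReal (Real.exp (-(n + 1 : ℝ)⁻¹))) atTop
      (𝓝 0) := by
    have h1 : Tendsto (fun n : ℕ => -(n + 1 : ℝ)⁻¹) atTop (𝓝 0) := by
      simpa using (tendsto_one_div_add_atTop_nhds_zero_nat (𝕜 := ℝ)).neg
    have h2 := ENNReal.tendsto_ofReal ((Real.continuous_exp.tendsto 0).comp h1)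
    have h3 := ENNReal.Tendsto.sub (tendsto_const_nhds (x := (1 : ℝ≥0∞))) h2 (by simp)
    simpa using h3
  exact le_antisymm (ge_of_tendsto' hlim key) zero_le

lemma measure_discreteM3_le {d : ℕ} {Ω Ω' : Type*} [MeasurableSpace Ω] [MeasurableSpace Ω']
    {F : (Fin d → ℤ) → Ω → ℝ≥0} (hF : ∀ t, Measurable (F t)) (P : Measure Ω) [SFinite P]
    (hsum : ∑' t, ∫⁻ ω, (F t ω : ℝ≥0∞) ∂P = 1)
    {X : ℕ → Ω' → ℝ × (Fin d → ℤ) × ((Fin d → ℤ) → ℝ≥0)} {P' : Measure Ω'}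
    [IsProbabilityMeasure P'] (hX : IsPoissonPointProcess X (discreteM3Intensity F P) P')
    {ι : Type*} [Fintype ι] (s : ι → Fin d → ℤ) {x : ι → ℝ} (hx : ∀ j, 0 < x j) :
    P' {ω | ∀ j, discreteM3 X (s j) ω ≤ x j}
      = ENNReal.ofReal (Real.exp (-(discreteM3Intensity F P (exceedance s x)).toReal)) := by
  rw [← hX.measure_forall_notMem (measurableSet_exceedance s x)
    (discreteM3Intensity_exceedance_ne_top hF P hsum s hx)]
  refine measure_congr ?_
  filter_upwards [ae_all_iff.2 fun j => ae_bddAbove_contribution hF P hsum hX (s j)] with ω hω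
  exact propext (forall_notMem_exceedance_iff X ω s x hω).symm

/-- The distribution function `exp(-1/y)` is continuous at `x`, so there is no atom. This makes
lower orthants continuity sets in the max-domain limit. -/
lemma measure_discreteM3_eq {d : ℕ} {Ω Ω' : Type*} [MeasurableSpace Ω] [MeasurableSpace Ω']
    {F : (Fin d → ℤ) → Ω → ℝ≥0} (hF : ∀ t, Measurable (F t)) (P : Measure Ω) [SFinite P]
    (hsum : ∑' t, ∫⁻ ω, (F t ω : ℝ≥0∞) ∂P = 1)
    {X : ℕ → Ω' → ℝ × (Fin d → ℤ) × ((Fin d → ℤ) → ℝ≥0)} {P' : Measure Ω'}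
    [IsProbabilityMeasure P'] (hX : IsPoissonPointProcess X (discreteM3Intensity F P) P')
    (s : Fin d → ℤ) {x : ℝ} (hx : 0 < x) :
    P' {ω | discreteM3 X s ω = x} = 0 := by
  have hcdf : ∀ y : ℝ, 0 < y →
      P' {ω | discreteM3 X s ω ≤ y} = ENNReal.ofReal (Real.exp (-y⁻¹)) := by
    intro y hy
    have h := measure_discreteM3_le hF P hsum hX (fun _ : Unit => s) (x := fun _ => y)
      fun _ => hy
    have he : exceedance (fun _ : Unit => s) (fun _ => y) = {p | y < contribution s p} := by
      ext p; simp [exceedance]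
    rw [he, discreteM3Intensity_lt_contribution hF P hsum s hy, ENNReal.toReal_inv,
      ENNReal.toReal_ofReal hy.le] at h
    simpa using h
  have hmeas : Measurable (discreteM3 X s) :=
    .iSup fun i => (measurable_contribution s).comp (hX.measurable i)
  have key : ∀ y ∈ Ioo 0 x, P' {ω | discreteM3 X s ω = x}
      ≤ ENNReal.ofReal (Real.exp (-x⁻¹)) - ENNReal.ofReal (Real.exp (-y⁻¹)) := by
    intro y hy
    rw [← hcdf x hx, ← hcdf y hy.1, ← measure_sdiff (ofPred_subset_ofPred.2 fun ω hω => hω.trans hy.2.le)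
      (measurableSet_le hmeas measurable_const).nullMeasurableSet (measure_ne_top _ _)]
    exact measure_mono fun ω hω => ⟨le_of_eq hω, fun h => by
      have h1 : discreteM3 X s ω ≤ y := h
      have h2 : discreteM3 X s ω = x := hω
      linarith [hy.2]⟩
  have hcont : Tendsto (fun y : ℝ => ENNReal.ofReal (Real.exp (-x⁻¹))
      - ENNReal.ofReal (Real.exp (-y⁻¹))) (𝓝[<] x) (𝓝 0) := by
    have h1 : Tendsto (fun y : ℝ => Real.exp (-y⁻¹)) (𝓝[<] x) (𝓝 (Real.exp (-x⁻¹))) :=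
      ((Real.continuous_exp.tendsto _).comp (tendsto_inv₀ hx.ne').neg).mono_left
        nhdsWithin_le_nhds
    have h3 := ENNReal.Tendsto.sub
      (tendsto_const_nhds (x := ENNReal.ofReal (Real.exp (-x⁻¹)))) (ENNReal.tendsto_ofReal h1)
      (by simp)
    simpa using h3
  exact le_antisymm (ge_of_tendsto hcont
    (Filter.eventually_of_mem (Ioo_mem_nhdsLT hx) key)) zero_le

/-! ### From the max-domain of attraction to tail asymptotics -/

/-- Logarithms give `n log p → -v`, hence `p → 1`, and the sandwich `p (-log p) ≤ 1 - p ≤ -log p`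
transfers the limit to `n (1 - p)`. -/
lemma tendsto_mul_one_sub_of_tendsto_pow {p : ℕ → ℝ} (hp0 : ∀ n, 0 ≤ p n) {v : ℝ}
    (h : Tendsto (fun n => p n ^ n) atTop (𝓝 (Real.exp (-v)))) :
    Tendsto (fun n : ℕ => n * (1 - p n)) atTop (𝓝 v) := by
  have hpos : ∀ᶠ n in atTop, 0 < p n := by
    filter_upwards [h.eventually (lt_mem_nhds (Real.exp_pos _)), eventually_gt_atTop 0]
      with n hn hn0
    refine (hp0 n).lt_of_ne fun h0 => ?_
    rw [← h0, zero_pow hn0.ne'] at hn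
    exact lt_irrefl _ hn
  have hlog : Tendsto (fun n : ℕ => n * Real.log (p n)) atTop (𝓝 (-v)) := by
    have h1 := h.log (Real.exp_pos _).ne'
    simpa [Real.log_pow] using h1
  have hlog0 : Tendsto (fun n : ℕ => Real.log (p n)) atTop (𝓝 0) := by
    have h1 := hlog.mul (tendsto_inv_atTop_nhds_zero_nat (𝕜 := ℝ))
    rw [mul_zero] at h1
    refine h1.congr' ?_
    filter_upwards [eventually_gt_atTop 0] with n hn
    have : (n : ℝ) ≠ 0 := by positivity
    field_simp
  have hp1 : Tendsto p atTop (𝓝 1) := by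
    have h1 := (Real.continuous_exp.tendsto 0).comp hlog0
    rw [Real.exp_zero] at h1
    refine h1.congr' ?_
    filter_upwards [hpos] with n hn using Real.exp_log hn
  have hup : Tendsto (fun n : ℕ => -(n * Real.log (p n))) atTop (𝓝 v) := by
    simpa using hlog.neg
  have hlo : Tendsto (fun n : ℕ => p n * -(n * Real.log (p n))) atTop (𝓝 v) := by
    simpa using hp1.mul hup
  refine tendsto_of_tendsto_of_tendsto_of_le_of_le' hlo hup ?_ ?_
  · filter_upwards [hpos] with n hn
    have h1 := Real.log_le_sub_one_of_pos (inv_pos.2 hn)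
    rw [Real.log_inv] at h1
    have h2 := mul_le_mul_of_nonneg_left h1 hn.le
    rw [mul_sub, mul_inv_cancel₀ hn.ne', mul_one] at h2
    calc p n * -(n * Real.log (p n)) = n * (p n * -Real.log (p n)) := by ring
      _ ≤ n * (1 - p n) := by gcongr
  · filter_upwards [hpos] with n hn
    have h1 := Real.log_le_sub_one_of_pos hn
    have : (n : ℝ) * (1 - p n) ≤ n * (-Real.log (p n)) := by gcongr; linarith
    linarith

section MaxDomain

variable {d : ℕ} {Ω Ω' ΩF : Type*}
    [MeasurableSpace Ω] [MeasurableSpace Ω'] [MeasurableSpace ΩF]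
    {P : Measure Ω} [IsProbabilityMeasure P] {P' : Measure Ω'} [IsProbabilityMeasure P']
    {PF : Measure ΩF} [IsProbabilityMeasure PF]
    {F : (Fin d → ℤ) → ΩF → ℝ≥0}
    {X : ℕ → Ω' → ℝ × (Fin d → ℤ) × ((Fin d → ℤ) → ℝ≥0)}
    {η : (Fin d → ℤ) → Ω → ℝ}

lemma infinitePi_max_le (hη : ∀ t, Measurable (η t)) {m : ℕ} (s : Fin m → Fin d → ℤ)
    (x : Fin m → ℝ) {n : ℕ} (hn : 0 < n) :
    (Measure.infinitePi fun _ : ℕ => P)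
        {w | ∀ j, 1 / (n : ℝ) * ((⨆ i : Fin n, η (s j) (w i)) - 0) ≤ x j}
      = P {ω | ∀ j, η (s j) ω ≤ n * x j} ^ n := by
  have hn' : (0 : ℝ) < n := by exact_mod_cast hn
  have hset : {w : ℕ → Ω | ∀ j, 1 / (n : ℝ) * ((⨆ i : Fin n, η (s j) (w i)) - 0) ≤ x j}
      = Set.pi (Finset.range n) fun _ => {ω | ∀ j, η (s j) ω ≤ n * x j} := by
    ext w
    simp only [mem_ofPred_eq, Set.mem_pi, Finset.coe_range, mem_Iio]
    rw [show (∀ i < n, ∀ j, η (s j) (w i) ≤ n * x j) ↔ ∀ j, ∀ i < n, η (s j) (w i) ≤ n * x j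
      from ⟨fun h j i hi => h i hi j, fun h i hi j => h j i hi⟩]
    refine forall_congr' fun j => ?_
    have : Nonempty (Fin n) := ⟨⟨0, hn⟩⟩
    rw [sub_zero, one_div, inv_mul_le_iff₀ hn', ciSup_le_iff (finite_range _).bddAbove]
    exact ⟨fun h i hi => h ⟨i, hi⟩, fun h i => h i i.2⟩
  have hmeas : MeasurableSet {ω | ∀ j, η (s j) ω ≤ n * x j} := by
    rw [ofPred_forall]
    exact .iInter fun j => measurableSet_le (hη _) measurable_const
  rw [hset, Measure.infinitePi_pi _ fun _ _ => hmeas]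
  simp

lemma tendsto_pow_of_inMDA (hF : ∀ t, Measurable (F t))
    (hsum : ∑' t, ∫⁻ ω, (F t ω : ℝ≥0∞) ∂PF = 1)
    (hX : IsPoissonPointProcess X (discreteM3Intensity F PF) P') (hη : ∀ t, Measurable (η t))
    (hMDA : InMDA η P (discreteM3 X) P' (fun n _ => 1 / (n : ℝ)) (fun _ _ => 0))
    {m : ℕ} (s : Fin m → Fin d → ℤ) {x : Fin m → ℝ} (hx : ∀ j, 0 < x j) :
    Tendsto (fun n : ℕ => P.real {ω | ∀ j, η (s j) ω ≤ n * x j} ^ n) atTop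
      (𝓝 (Real.exp (-(discreteM3Intensity F PF (exceedance s x)).toReal))) := by
  have hm := hMDA m s
  have hE : MeasurableSet {y : Fin m → ℝ | ∀ j, y j ≤ x j} := by
    rw [ofPred_forall]
    exact .iInter fun j => measurableSet_le (measurable_pi_apply j) measurable_const
  have hcl : IsClosed {y : Fin m → ℝ | ∀ j, y j ≤ x j} := by
    rw [ofPred_forall]
    exact isClosed_iInter fun j => isClosed_le (continuous_apply j) continuous_const
  have hop : IsOpen {y : Fin m → ℝ | ∀ j, y j < x j} := by
    rw [ofPred_forall]
    exact isOpen_iInter_of_finite fun j => isOpen_lt (continuous_apply j) continuous_const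
  -- The frontier of an orthant lies in finitely many hyperplanes, each null because the margins of
  -- `M` have no atom at `x j`.
  have hfr : frontier {y : Fin m → ℝ | ∀ j, y j ≤ x j} ⊆ ⋃ j, {y | y j = x j} := by
    intro y hy
    rw [frontier, hcl.closure_eq] at hy
    by_contra hcon
    simp only [mem_iUnion, mem_ofPred_eq, not_exists] at hcon
    refine hy.2 (interior_maximal (ofPred_subset_ofPred.2 fun z hz j => (hz j).le) hop ?_)
    exact fun j => (hy.1 j).lt_of_ne (hcon j)
  have hnull : P'.map (fun ω j => discreteM3 X (s j) ω)
      (frontier {y : Fin m → ℝ | ∀ j, y j ≤ x j}) = 0 := by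
    refine measure_mono_null hfr (measure_iUnion_null fun j => ?_)
    rw [Measure.map_apply_of_aemeasurable hm.aemeasurable_limit
      (measurableSet_eq_fun (measurable_pi_apply j) measurable_const)]
    exact measure_discreteM3_eq hF PF hsum hX (s j) (hx j)
  have key := ProbabilityMeasure.tendsto_measure_of_null_frontier_of_tendsto' hm.tendsto hnull
  simp only [ProbabilityMeasure.coe_mk] at key
  rw [Measure.map_apply_of_aemeasurable hm.aemeasurable_limit hE] at key
  have hlim : P' ((fun ω j => discreteM3 X (s j) ω) ⁻¹' {y : Fin m → ℝ | ∀ j, y j ≤ x j})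
      = ENNReal.ofReal (Real.exp (-(discreteM3Intensity F PF (exceedance s x)).toReal)) :=
    measure_discreteM3_le hF PF hsum hX s hx
  rw [hlim] at key
  have key2 := (ENNReal.tendsto_toReal ENNReal.ofReal_ne_top).comp key
  rw [ENNReal.toReal_ofReal (Real.exp_pos _).le] at key2
  refine key2.congr' ?_
  filter_upwards [eventually_gt_atTop 0] with n hn
  simp only [Function.comp_apply]
  rw [Measure.map_apply_of_aemeasurable (hm.forall_aemeasurable n) hE, measureReal_def,
    ← ENNReal.toReal_pow, ← infinitePi_max_le hη s x hn]
  rfl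

lemma tendsto_nat_mul_measureReal_exceed (hF : ∀ t, Measurable (F t))
    (hsum : ∑' t, ∫⁻ ω, (F t ω : ℝ≥0∞) ∂PF = 1)
    (hX : IsPoissonPointProcess X (discreteM3Intensity F PF) P') (hη : ∀ t, Measurable (η t))
    (hMDA : InMDA η P (discreteM3 X) P' (fun n _ => 1 / (n : ℝ)) (fun _ _ => 0))
    {ι : Type*} [Fintype ι] (s : ι → Fin d → ℤ) {x : ι → ℝ} (hx : ∀ j, 0 < x j) :
    Tendsto (fun n : ℕ => n * P.real {ω | ∃ j, n * x j < η (s j) ω}) atTop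
      (𝓝 ((discreteM3Intensity F PF (exceedance s x)).toReal)) := by
  let e := (Fintype.equivFin ι).symm
  have h := tendsto_mul_one_sub_of_tendsto_pow (fun n => measureReal_nonneg)
    (tendsto_pow_of_inMDA hF hsum hX hη hMDA (s ∘ e) (x := x ∘ e) fun j => hx _)
  have hex : exceedance (s ∘ e) (x ∘ e) = exceedance s x := by
    ext p
    exact e.exists_congr_left.trans (by simp [exceedance])
  rw [hex] at h
  refine h.congr fun n => ?_
  have hmeas : MeasurableSet {ω | ∀ j, η ((s ∘ e) j) ω ≤ n * (x ∘ e) j} := by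
    rw [ofPred_forall]
    exact .iInter fun j => measurableSet_le (hη _) measurable_const
  rw [← probReal_compl_eq_one_sub hmeas]
  congr 2
  ext ω
  simp only [mem_compl_iff, mem_ofPred_eq, not_forall, not_le, Function.comp_apply]
  exact ⟨fun ⟨j, hj⟩ => ⟨e j, hj⟩, fun ⟨j, hj⟩ => ⟨e.symm j, by simpa using hj⟩⟩

/-- The exceedance probability decreases in the level, so its value at `a` lies between those at
`⌊a⌋ + 1` and `⌊a⌋`; both integers are asymptotic to `a`. Real levels are needed since `a(n)` is an
arbitrary real sequence. -/
lemma tendsto_mul_measureReal_exceed (hF : ∀ t, Measurable (F t))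
    (hsum : ∑' t, ∫⁻ ω, (F t ω : ℝ≥0∞) ∂PF = 1)
    (hX : IsPoissonPointProcess X (discreteM3Intensity F PF) P') (hη : ∀ t, Measurable (η t))
    (hMDA : InMDA η P (discreteM3 X) P' (fun n _ => 1 / (n : ℝ)) (fun _ _ => 0))
    {ι : Type*} [Fintype ι] (s : ι → Fin d → ℤ) {x : ι → ℝ} (hx : ∀ j, 0 < x j) :
    Tendsto (fun a : ℝ => a * P.real {ω | ∃ j, a * x j < η (s j) ω}) atTop
      (𝓝 ((discreteM3Intensity F PF (exceedance s x)).toReal)) := by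
  set V := (discreteM3Intensity F PF (exceedance s x)).toReal
  have h := tendsto_nat_mul_measureReal_exceed hF hsum hX hη hMDA s hx
  have hanti : ∀ {a b : ℝ}, a ≤ b → P.real {ω | ∃ j, b * x j < η (s j) ω}
      ≤ P.real {ω | ∃ j, a * x j < η (s j) ω} := fun hab =>
    measureReal_mono (ofPred_subset_ofPred.2 fun ω ⟨j, hj⟩ =>
      ⟨j, (mul_le_mul_of_nonneg_right hab (hx j).le).trans_lt hj⟩)
  have hfl := tendsto_nat_floor_atTop (α := ℝ)
  have hratio : Tendsto (fun a : ℝ => (⌊a⌋₊ : ℝ) / a) atTop (𝓝 1) :=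
    tendsto_nat_floor_div_atTop
  have hup : Tendsto (fun a : ℝ => ((⌊a⌋₊ : ℝ) / a)⁻¹
      * (⌊a⌋₊ * P.real {ω | ∃ j, (⌊a⌋₊ : ℝ) * x j < η (s j) ω})) atTop (𝓝 V) := by
    simpa using (hratio.inv₀ one_ne_zero).mul (h.comp hfl)
  have hratio' : Tendsto (fun a : ℝ => ((⌊a⌋₊ + 1 : ℕ) : ℝ) / a) atTop (𝓝 1) := by
    have := hratio.add (tendsto_inv_atTop_zero (𝕜 := ℝ))
    simpa [add_div] using this
  have hlo : Tendsto (fun a : ℝ => (((⌊a⌋₊ + 1 : ℕ) : ℝ) / a)⁻¹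
      * ((⌊a⌋₊ + 1 : ℕ) * P.real {ω | ∃ j, ((⌊a⌋₊ + 1 : ℕ) : ℝ) * x j < η (s j) ω}))
      atTop (𝓝 V) := by
    simpa only [inv_one, one_mul, Function.comp_def] using
      (hratio'.inv₀ one_ne_zero).mul (h.comp ((tendsto_add_atTop_nat 1).comp hfl))
  refine tendsto_of_tendsto_of_tendsto_of_le_of_le' hlo hup ?_ ?_
  · filter_upwards [eventually_ge_atTop 1] with a ha
    have h1 : (((⌊a⌋₊ + 1 : ℕ) : ℝ)) ≠ 0 := by positivity
    rw [inv_div, ← mul_assoc, div_mul_cancel₀ _ h1]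
    gcongr a * ?_
    exact hanti (by push_cast; exact (Nat.lt_floor_add_one a).le)
  · filter_upwards [eventually_ge_atTop 1] with a ha
    have h1 : (⌊a⌋₊ : ℝ) ≠ 0 := by
      have : 0 < ⌊a⌋₊ := Nat.floor_pos.2 ha
      positivity
    rw [inv_div, ← mul_assoc, div_mul_cancel₀ _ h1]
    gcongr a * ?_
    exact hanti (Nat.floor_le (by linarith))

end MaxDomain

/-! ### Weak convergence on `[0, ∞)^ι` from distribution functions -/

/-- The intervals `[0, y]` and `(z, y]` of `[0, ∞)` with positive end points. -/
def positiveIntervals : Set (Set ℝ≥0) :=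
  {I | ∃ y, 0 < y ∧ (I = Iic y ∨ ∃ z, 0 < z ∧ I = Iic y \ Iic z)}

lemma isPiSystem_positiveIntervals : IsPiSystem positiveIntervals := by
  rintro _ ⟨y, hy, h⟩ _ ⟨y', hy', h'⟩ -
  refine ⟨min y y', lt_min hy hy', ?_⟩
  rcases h with rfl | ⟨z, hz, rfl⟩ <;> rcases h' with rfl | ⟨z', hz', rfl⟩
  · left; ext; simp
  · right; exact ⟨z', hz', by ext; simp; tauto⟩
  · right; exact ⟨z, hz, by ext; simp⟩
  · right; exact ⟨max z z', lt_max_of_lt_left hz, by ext; simp; tauto⟩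

lemma measurableSet_of_mem_positiveIntervals {I : Set ℝ≥0} (hI : I ∈ positiveIntervals) :
    MeasurableSet I := by
  obtain ⟨y, -, rfl | ⟨z, -, rfl⟩⟩ := hI
  · exact measurableSet_Iic
  · exact measurableSet_Iic.diff measurableSet_Iic

/-- The intervals `[0, y]` serve as neighbourhoods of `0`, so no interval end point has to be `0`, a
level at which the exceedance intensity need not be finite. -/
lemma exists_positiveInterval_subset {x : ℝ≥0} {u : Set ℝ≥0} (hu : u ∈ 𝓝 x) :
    ∃ I ∈ positiveIntervals, I ∈ 𝓝 x ∧ I ⊆ u := by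
  obtain ⟨r, hxr, hr⟩ := exists_Ico_subset_of_mem_nhds hu ⟨x + 1, by simp⟩
  obtain ⟨y, hxy, hyr⟩ := exists_between hxr
  have hy : 0 < y := zero_le.trans_lt hxy
  rcases eq_or_ne x 0 with rfl | hx
  · exact ⟨Iic y, ⟨y, hy, .inl rfl⟩, Iic_mem_nhds hxy,
      fun v hv => hr ⟨zero_le, lt_of_le_of_lt hv hyr⟩⟩
  · obtain ⟨l, hlx, hl⟩ := exists_Ioc_subset_of_mem_nhds hu ⟨0, pos_iff_ne_zero.2 hx⟩
    obtain ⟨z, hlz, hzx⟩ := exists_between hlx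
    refine ⟨Iic y \ Iic z, ⟨y, hy, .inr ⟨z, zero_le.trans_lt hlz, rfl⟩⟩, ?_, ?_⟩
    · filter_upwards [Ioo_mem_nhds hzx hxy] with v hv using ⟨hv.2.le, not_le.2 hv.1⟩
    · rintro v ⟨hv1, hv2⟩
      have hv1' : v ≤ y := hv1
      have hv2' : z < v := not_le.1 hv2
      rcases le_total v x with h | h
      · exact hl ⟨hlz.trans hv2', h⟩
      · exact hr ⟨h, hv1'.trans_lt hyr⟩

/-- Probability measures on `[0, ∞)^ι` converge weakly as soon as their distribution functions
converge at all points with positive coordinates. -/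
lemma tendsto_probabilityMeasure_of_tendsto_Iic {ι α : Type*} [Fintype ι] {l : Filter α}
    [l.IsCountablyGenerated] {μ : α → ProbabilityMeasure (ι → ℝ≥0)}
    {ν : ProbabilityMeasure (ι → ℝ≥0)}
    (h : ∀ y : ι → ℝ≥0, (∀ j, 0 < y j) →
      Tendsto (fun i => (μ i : Measure (ι → ℝ≥0)).real (Iic y)) l
        (𝓝 ((ν : Measure (ι → ℝ≥0)).real (Iic y)))) :
    Tendsto μ l (𝓝 ν) := by
  classical
  have hmeas : ∀ I : ι → Set ℝ≥0, (∀ j, I j ∈ positiveIntervals) →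
      MeasurableSet (univ.pi I) := fun I hI =>
    .univ_pi fun j => measurableSet_of_mem_positiveIntervals (hI j)
  -- Inclusion–exclusion one coordinate at a time: `J` contains all coordinates whose interval may
  -- have a lower end point.
  have key : ∀ J : Finset ι, ∀ I : ι → Set ℝ≥0, (∀ j, I j ∈ positiveIntervals) →
      (∀ j ∉ J, ∃ y, 0 < y ∧ I j = Iic y) →
      Tendsto (fun i => (μ i : Measure (ι → ℝ≥0)).real (univ.pi I)) l
        (𝓝 ((ν : Measure (ι → ℝ≥0)).real (univ.pi I))) := by
    intro J
    induction J using Finset.induction_on with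
    | empty =>
      intro I _ hI
      choose y hy hIy using fun j => hI j (Finset.notMem_empty j)
      obtain rfl : I = fun j => Iic (y j) := funext hIy
      rw [pi_univ_Iic]
      exact h y hy
    | insert j J _ ih =>
      intro I hI hIJ
      have hstep : ∀ y, 0 < y → ∃ I', I' = Function.update I j (Iic y) ∧
          (∀ i, I' i ∈ positiveIntervals) ∧ ∀ i ∉ J, ∃ y, 0 < y ∧ I' i = Iic y := by
        intro y hy
        refine ⟨_, rfl, fun i => ?_, fun i hi => ?_⟩
        · rcases eq_or_ne i j with rfl | hij
          · simpa using ⟨y, hy, .inl rfl⟩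
          · simpa [hij] using hI i
        · rcases eq_or_ne i j with rfl | hij
          · exact ⟨y, hy, by simp⟩
          · simpa [hij] using hIJ i (by simp [hij, hi])
      obtain ⟨y, hy, hIj | ⟨z, hz, hIj⟩⟩ := hI j
      · refine ih I hI fun i hi => ?_
        rcases eq_or_ne i j with rfl | hij
        · exact ⟨y, hy, hIj⟩
        · exact hIJ i (by simp [hij, hi])
      · obtain ⟨I₁, hI₁, hI₁p, hI₁J⟩ := hstep y hy
        -- The minimum keeps the second box inside the first even if `y < z`, when `(z, y]` is
        -- empty.
        obtain ⟨I₂, hI₂, hI₂p, hI₂J⟩ := hstep (min y z) (lt_min hy hz)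
        have hsub : univ.pi I₂ ⊆ univ.pi I₁ := by
          refine pi_mono fun i _ => ?_
          rcases eq_or_ne i j with rfl | hij
          · simp only [hI₁, hI₂, Function.update_self]
            exact Iic_subset_Iic.2 (min_le_left _ _)
          · simp [hI₁, hI₂, hij]
        have hdiff : univ.pi I = univ.pi I₁ \ univ.pi I₂ := by
          ext v
          simp only [Set.mem_sdiff, mem_univ_pi, hI₁, hI₂]
          rw [Function.forall_update_iff I (p := fun i s => v i ∈ s),
            Function.forall_update_iff I (p := fun i s => v i ∈ s)]
          constructor
          · intro hv
            have hvj := hv j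
            rw [hIj] at hvj
            refine ⟨⟨hvj.1, fun i _ => hv i⟩, fun hcon => hvj.2 ?_⟩
            exact le_trans (mem_Iic.1 hcon.1) (min_le_right _ _)
          · rintro ⟨⟨hv1, hv2⟩, hv3⟩ i
            rcases eq_or_ne i j with rfl | hij
            · rw [hIj]
              exact ⟨hv1, fun hcon => hv3 ⟨mem_Iic.2 (le_min hv1 hcon), hv2⟩⟩
            · exact hv2 i hij
        have hlim := (ih I₁ hI₁p hI₁J).sub (ih I₂ hI₂p hI₂J)
        rw [hdiff, measureReal_sdiff hsub (hmeas _ hI₂p)]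
        refine hlim.congr fun i => ?_
        rw [measureReal_sdiff hsub (hmeas _ hI₂p)]
  refine IsPiSystem.tendsto_probabilityMeasure_of_tendsto_of_mem
    (S := univ.pi '' univ.pi fun _ : ι => positiveIntervals)
    (IsPiSystem.pi fun _ => isPiSystem_positiveIntervals) ?_ ?_ ?_
  · rintro _ ⟨I, hI, rfl⟩
    exact hmeas I fun j => hI j (mem_univ j)
  · intro u hu x hx
    have hux : u ∈ 𝓝 x := hu.mem_nhds hx
    rw [nhds_pi, Filter.mem_pi] at hux
    obtain ⟨K, -, v, hv, hvu⟩ := hux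
    choose I hI hIx hIv using fun j => exists_positiveInterval_subset (hv j)
    exact ⟨univ.pi I, ⟨I, fun j _ => hI j, rfl⟩, set_pi_mem_nhds finite_univ fun j _ => hIx j,
      (pi_mono' (fun j _ => hIv j) (subset_univ K)).trans hvu⟩
  · rintro _ ⟨I, hI, rfl⟩
    have := key Finset.univ I (fun j => hI j (mem_univ j)) fun j hj => absurd (Finset.mem_univ j) hj
    exact (NNReal.tendsto_coe).1 (by simpa using this)

/-! ### The conditional limit given a high value at one site -/

/-- The contributions of a point `(u, t, f)` at the sites `s j`, as a vector in `[0, ∞)^ι`. -/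
noncomputable def contributionVector {d : ℕ} {ι : Type*} (s : ι → Fin d → ℤ)
    (p : ℝ × (Fin d → ℤ) × ((Fin d → ℤ) → ℝ≥0)) (j : ι) : ℝ≥0 :=
  (contribution (s j) p).toNNReal

/-- The law of the contributions at the sites `s j` of a point whose contribution at `s₀`
exceeds `1`. -/
noncomputable def exceedanceLaw {d : ℕ} {Ω ι : Type*} [MeasurableSpace Ω]
    (F : (Fin d → ℤ) → Ω → ℝ≥0) (P : Measure Ω) (s : ι → Fin d → ℤ) (s₀ : Fin d → ℤ) :
    Measure (ι → ℝ≥0) :=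
  ((discreteM3Intensity F P).restrict {p | 1 < contribution s₀ p}).map (contributionVector s)

/-- The law of `(η (s j) / a)⁺` given `η s₀ > a`. -/
noncomputable def conditionalLaw {d : ℕ} {Ω ι : Type*} [MeasurableSpace Ω]
    (η : (Fin d → ℤ) → Ω → ℝ) (P : Measure Ω) (s : ι → Fin d → ℤ) (s₀ : Fin d → ℤ) (a : ℝ) :
    Measure (ι → ℝ≥0) :=
  (P[|{ω | a < η s₀ ω}]).map fun ω j => (η (s j) ω / a).toNNReal

section

variable {d : ℕ} {Ω Ω' ΩF : Type*}
    [MeasurableSpace Ω] [MeasurableSpace Ω'] [MeasurableSpace ΩF]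
    {P : Measure Ω} [IsProbabilityMeasure P] {P' : Measure Ω'} [IsProbabilityMeasure P']
    {PF : Measure ΩF} [IsProbabilityMeasure PF]
    {F : (Fin d → ℤ) → ΩF → ℝ≥0}
    {X : ℕ → Ω' → ℝ × (Fin d → ℤ) × ((Fin d → ℤ) → ℝ≥0)}
    {η : (Fin d → ℤ) → Ω → ℝ}

lemma measurable_contributionVector {ι : Type*} (s : ι → Fin d → ℤ) :
    Measurable (contributionVector s) :=
  measurable_pi_lambda _ fun j => (measurable_contribution (s j)).real_toNNReal

lemma measurable_scaled {ι : Type*} (hη : ∀ t, Measurable (η t)) (s : ι → Fin d → ℤ) (a : ℝ) :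
    Measurable fun ω (j : ι) => (η (s j) ω / a).toNNReal :=
  measurable_pi_lambda _ fun j => ((hη (s j)).div_const a).real_toNNReal

lemma isProbabilityMeasure_exceedanceLaw (hF : ∀ t, Measurable (F t))
    (hsum : ∑' t, ∫⁻ ω, (F t ω : ℝ≥0∞) ∂PF = 1) {ι : Type*} (s : ι → Fin d → ℤ)
    (s₀ : Fin d → ℤ) : IsProbabilityMeasure (exceedanceLaw F PF s s₀) := by
  have : IsProbabilityMeasure ((discreteM3Intensity F PF).restrict {p | 1 < contribution s₀ p}) :=
    ⟨by rw [Measure.restrict_apply_univ,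
      discreteM3Intensity_lt_contribution hF PF hsum s₀ one_pos]; simp⟩
  exact Measure.isProbabilityMeasure_map (measurable_contributionVector s).aemeasurable

lemma tendsto_mul_measureReal_lt (hF : ∀ t, Measurable (F t))
    (hsum : ∑' t, ∫⁻ ω, (F t ω : ℝ≥0∞) ∂PF = 1)
    (hX : IsPoissonPointProcess X (discreteM3Intensity F PF) P') (hη : ∀ t, Measurable (η t))
    (hMDA : InMDA η P (discreteM3 X) P' (fun n _ => 1 / (n : ℝ)) (fun _ _ => 0))
    (s₀ : Fin d → ℤ) {x : ℝ} (hx : 0 < x) :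
    Tendsto (fun a : ℝ => a * P.real {ω | a * x < η s₀ ω}) atTop (𝓝 x⁻¹) := by
  have h := tendsto_mul_measureReal_exceed hF hsum hX hη hMDA (fun _ : Unit => s₀)
    (x := fun _ => x) fun _ => hx
  have he : exceedance (fun _ : Unit => s₀) (fun _ => x) = {p | x < contribution s₀ p} := by
    ext p; simp [exceedance]
  rw [he, discreteM3Intensity_lt_contribution hF PF hsum s₀ hx, ENNReal.toReal_inv,
    ENNReal.toReal_ofReal hx.le] at h
  simpa using h

/-- For `x < 1` the event `η s₀ = a` lies in `a x < η s₀ ≤ a`, whose rescaled probability tends to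
`1/x - 1`; then `x` increases to `1`. The event of interest uses `η s₀ ≥ a`, the conditioning uses
`η s₀ > a`, and this bounds the difference. -/
lemma tendsto_mul_measureReal_eq (hF : ∀ t, Measurable (F t))
    (hsum : ∑' t, ∫⁻ ω, (F t ω : ℝ≥0∞) ∂PF = 1)
    (hX : IsPoissonPointProcess X (discreteM3Intensity F PF) P') (hη : ∀ t, Measurable (η t))
    (hMDA : InMDA η P (discreteM3 X) P' (fun n _ => 1 / (n : ℝ)) (fun _ _ => 0))
    (s₀ : Fin d → ℤ) :
    Tendsto (fun a : ℝ => a * P.real {ω | η s₀ ω = a}) atTop (𝓝 0) := by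
  have hlim {x : ℝ} (hx : 0 < x) := tendsto_mul_measureReal_lt hF hsum hX hη hMDA s₀ hx
  refine tendsto_order.2 ⟨fun e he => ?_, fun e he => ?_⟩
  · filter_upwards [eventually_ge_atTop 0] with a ha
    exact he.trans_le (mul_nonneg ha measureReal_nonneg)
  · have hc : Tendsto (fun x : ℝ => x⁻¹ - 1⁻¹) (𝓝[<] 1) (𝓝 0) := by
      have := (tendsto_inv₀ (one_ne_zero (α := ℝ))).sub_const 1⁻¹
      rw [sub_self] at this
      exact this.mono_left nhdsWithin_le_nhds
    obtain ⟨x, hxe, hx0, hx1⟩ := ((hc.eventually (gt_mem_nhds he)).and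
      (Ioo_mem_nhdsLT (zero_lt_one (α := ℝ)))).exists
    filter_upwards [((hlim hx0).sub (hlim one_pos)).eventually (gt_mem_nhds hxe),
      eventually_gt_atTop 0] with a ha ha0
    refine lt_of_le_of_lt ?_ ha
    rw [← mul_sub]
    gcongr
    rw [← measureReal_sdiff (ofPred_subset_ofPred.2 fun ω hω => ?_)
      (measurableSet_lt measurable_const (hη s₀))]
    · refine measureReal_mono fun ω hω => ⟨?_, fun h => ?_⟩
      · have h1 : η s₀ ω = a := hω
        change a * x < η s₀ ω
        rw [h1]
        exact mul_lt_of_lt_one_right ha0 hx1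
      · have h1 : η s₀ ω = a := hω
        have h2 : a * 1 < η s₀ ω := h
        linarith
    · exact (mul_le_mul_of_nonneg_left hx1.le ha0.le).trans_lt hω

lemma measure_lt_ne_zero (hF : ∀ t, Measurable (F t))
    (hsum : ∑' t, ∫⁻ ω, (F t ω : ℝ≥0∞) ∂PF = 1)
    (hX : IsPoissonPointProcess X (discreteM3Intensity F PF) P') (hη : ∀ t, Measurable (η t))
    (hMDA : InMDA η P (discreteM3 X) P' (fun n _ => 1 / (n : ℝ)) (fun _ _ => 0))
    (s₀ : Fin d → ℤ) (a : ℝ) : P {ω | a < η s₀ ω} ≠ 0 := by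
  intro h0
  have hlim := tendsto_mul_measureReal_lt hF hsum hX hη hMDA s₀ one_pos
  obtain ⟨b, hb, hab⟩ := ((hlim.eventually (lt_mem_nhds (by norm_num : (0 : ℝ) < 1⁻¹))).and
    (eventually_ge_atTop a)).exists
  have : P {ω | b * 1 < η s₀ ω} = 0 :=
    measure_mono_null (ofPred_subset_ofPred.2 fun ω hω => by linarith) h0
  rw [measureReal_def, this] at hb
  simp at hb

lemma isProbabilityMeasure_conditionalLaw (hη : ∀ t, Measurable (η t)) {ι : Type*}
    (s : ι → Fin d → ℤ) {s₀ : Fin d → ℤ} {a : ℝ} (h : P {ω | a < η s₀ ω} ≠ 0) :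
    IsProbabilityMeasure (conditionalLaw η P s s₀ a) := by
  have := cond_isProbabilityMeasure h
  exact Measure.isProbabilityMeasure_map (measurable_scaled hη s a).aemeasurable

/-- Exceeding `1` at `s₀` while staying below `y` at every `s j` is the difference of two exceedance
sets. The extra index `none` carries the site `s₀` with level `1`. -/
lemma exceedanceLaw_Iic (hF : ∀ t, Measurable (F t))
    (hsum : ∑' t, ∫⁻ ω, (F t ω : ℝ≥0∞) ∂PF = 1) {ι : Type*} [Fintype ι] (s : ι → Fin d → ℤ)
    (s₀ : Fin d → ℤ) {y : ι → ℝ≥0} (hy : ∀ j, 0 < y j) :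
    (exceedanceLaw F PF s s₀).real (Iic y)
      = (discreteM3Intensity F PF (exceedance (fun j : Option ι => j.elim s₀ s)
          fun j => j.elim 1 fun j => (y j : ℝ))).toReal
        - (discreteM3Intensity F PF (exceedance s fun j => (y j : ℝ))).toReal := by
  have hpos : ∀ j : Option ι, (0 : ℝ) < j.elim 1 fun j => (y j : ℝ) := by
    rintro (_ | j)
    · exact one_pos
    · exact hy j
  have hsub : exceedance s (fun j => (y j : ℝ)) ⊆ exceedance (fun j : Option ι => j.elim s₀ s)
      fun j => j.elim 1 fun j => (y j : ℝ) := ofPred_subset_ofPred.2 fun p ⟨j, hj⟩ => ⟨some j, hj⟩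
  have hfin := discreteM3Intensity_exceedance_ne_top hF PF hsum
    (fun j : Option ι => j.elim s₀ s) hpos
  have h1 := measureReal_sdiff hsub (measurableSet_exceedance s _) hfin
  rw [← measureReal_def, ← measureReal_def, ← h1, measureReal_def, measureReal_def,
    exceedanceLaw,
    Measure.map_apply (measurable_contributionVector s) measurableSet_Iic,
    Measure.restrict_apply (measurable_contributionVector s measurableSet_Iic)]
  congr 2
  ext p
  simp only [mem_inter_iff, mem_preimage, mem_Iic, Pi.le_def, mem_ofPred_eq, exceedance,
    Set.mem_sdiff, contributionVector, Real.toNNReal_le_iff_le_coe, Option.exists, Option.elim,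
    not_exists, not_lt]
  constructor
  · exact fun ⟨h, h'⟩ => ⟨.inl h', h⟩
  · rintro ⟨h | ⟨j, hj⟩, h'⟩
    · exact ⟨h', h⟩
    · exact absurd hj (not_lt.2 (h' j))

lemma conditionalLaw_Iic (hη : ∀ t, Measurable (η t)) {ι : Type*} [Fintype ι]
    (s : ι → Fin d → ℤ) (s₀ : Fin d → ℤ) (y : ι → ℝ≥0) {a : ℝ} (ha : 0 < a) :
    (conditionalLaw η P s s₀ a).real (Iic y)
      = (a * P.real {ω | a * 1 < η s₀ ω})⁻¹ *
        (a * P.real {ω | ∃ j : Option ι, a * (j.elim 1 fun j => (y j : ℝ)) < η (j.elim s₀ s) ω}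
          - a * P.real {ω | ∃ j, a * (y j : ℝ) < η (s j) ω}) := by
  have hm : MeasurableSet {ω | ∃ j, a * (y j : ℝ) < η (s j) ω} := by
    rw [ofPred_exists]
    exact .iUnion fun j => measurableSet_lt measurable_const (hη _)
  have hsub : {ω | ∃ j, a * (y j : ℝ) < η (s j) ω} ⊆
      {ω | ∃ j : Option ι, a * (j.elim 1 fun j => (y j : ℝ)) < η (j.elim s₀ s) ω} :=
    ofPred_subset_ofPred.2 fun p ⟨j, hj⟩ => ⟨some j, hj⟩
  rw [← mul_sub, ← measureReal_sdiff hsub hm, measureReal_def, conditionalLaw,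
    Measure.map_apply (measurable_scaled hη s a) measurableSet_Iic,
    cond_apply (measurableSet_lt measurable_const (hη s₀)), ENNReal.toReal_mul,
    ENNReal.toReal_inv, ← measureReal_def, ← measureReal_def, mul_one, mul_inv]
  have hset : {ω | a < η s₀ ω} ∩ (fun ω (j : ι) => (η (s j) ω / a).toNNReal) ⁻¹' Iic y
      = {ω | ∃ j : Option ι, a * (j.elim 1 fun j => (y j : ℝ)) < η (j.elim s₀ s) ω} \
        {ω | ∃ j, a * (y j : ℝ) < η (s j) ω} := by
    ext ω
    simp only [mem_inter_iff, mem_preimage, mem_Iic, Pi.le_def, mem_ofPred_eq,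
      Set.mem_sdiff, Real.toNNReal_le_iff_le_coe, Option.exists, Option.elim,
      not_exists, not_lt, div_le_iff₀' ha, mul_one]
    constructor
    · exact fun ⟨h, h'⟩ => ⟨.inl h, h'⟩
    · rintro ⟨h | ⟨j, hj⟩, h'⟩
      · exact ⟨h, h'⟩
      · exact absurd hj (not_lt.2 (h' j))
  rw [hset]
  field_simp

/-- Given that `η s₀` exceeds a high level, the rescaled process has approximately the law of the
contributions of a Poisson point which exceeds `1` at `s₀`. -/
theorem tendsto_conditionalLaw (hF : ∀ t, Measurable (F t))
    (hsum : ∑' t, ∫⁻ ω, (F t ω : ℝ≥0∞) ∂PF = 1)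
    (hX : IsPoissonPointProcess X (discreteM3Intensity F PF) P') (hη : ∀ t, Measurable (η t))
    (hMDA : InMDA η P (discreteM3 X) P' (fun n _ => 1 / (n : ℝ)) (fun _ _ => 0))
    {ι : Type*} [Fintype ι] (s : ι → Fin d → ℤ) (s₀ : Fin d → ℤ) :
    Tendsto (β := ProbabilityMeasure (ι → ℝ≥0))
      (fun a : ℝ => ⟨conditionalLaw η P s s₀ a,
        isProbabilityMeasure_conditionalLaw hη s (measure_lt_ne_zero hF hsum hX hη hMDA s₀ a)⟩)
      atTop (𝓝 ⟨exceedanceLaw F PF s s₀, isProbabilityMeasure_exceedanceLaw hF hsum s s₀⟩) := by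
  refine tendsto_probabilityMeasure_of_tendsto_Iic fun y hy => ?_
  simp only [ProbabilityMeasure.coe_mk]
  have hpos : ∀ j : Option ι, (0 : ℝ) < j.elim 1 fun j => (y j : ℝ) := by
    rintro (_ | j)
    · exact one_pos
    · exact hy j
  have h1 := tendsto_mul_measureReal_lt hF hsum hX hη hMDA s₀ one_pos
  have h2 := tendsto_mul_measureReal_exceed hF hsum hX hη hMDA
    (fun j : Option ι => j.elim s₀ s) hpos
  have h3 := tendsto_mul_measureReal_exceed hF hsum hX hη hMDA s (x := fun j => (y j : ℝ))
    fun j => hy j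
  have h4 := (h1.inv₀ (by norm_num)).mul (h2.sub h3)
  rw [exceedanceLaw_Iic hF hsum s s₀ hy]
  simp only [inv_one, one_mul] at h4
  refine h4.congr' ?_
  filter_upwards [eventually_gt_atTop 0] with a ha
  rw [conditionalLaw_Iic hη s s₀ y ha]

end

/-! ### Local maxima under the limit law -/

/-- The sites `s₀`, `s₀ + l` for `l ∈ L`, and `s₀ + τ i`. -/
def siteFamily {d k : ℕ} (s₀ : Fin d → ℤ) (L : Finset (Fin d → ℤ)) (τ : Fin k → Fin d → ℤ) :
    Option (L ⊕ Fin k) → Fin d → ℤ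
  | none => s₀
  | some (.inl l) => s₀ + l
  | some (.inr i) => s₀ + τ i

/-- Vectors whose entry at `s₀` is positive and strictly larger than the other entries over
`s₀ + L`, and whose entries at `s₀ + τ i` have ratios to it in `O`. -/
def strictMaxRatioSet {d k : ℕ} (L : Finset (Fin d → ℤ)) (O : Set (Fin k → ℝ≥0)) :
    Set (Option (L ⊕ Fin k) → ℝ≥0) :=
  {y | 0 < y none ∧ (∀ l : L, (l : Fin d → ℤ) ≠ 0 → y (some (.inl l)) < y none) ∧
    (fun i => y (some (.inr i)) / y none) ∈ O}

/-- Vectors whose entry at `s₀` is at least `1` and maximal over `s₀ + L`, and whose entries at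
`s₀ + τ i` have ratios to it in `C`. -/
def maxRatioSet {d k : ℕ} (L : Finset (Fin d → ℤ)) (C : Set (Fin k → ℝ≥0)) :
    Set (Option (L ⊕ Fin k) → ℝ≥0) :=
  {y | 1 ≤ y none ∧ (∀ l : L, y (some (.inl l)) ≤ y none) ∧
    (fun i => y (some (.inr i)) / y none) ∈ C}

lemma continuousOn_ratio {d k : ℕ} (L : Finset (Fin d → ℤ)) :
    ContinuousOn (fun (y : Option (L ⊕ Fin k) → ℝ≥0) (i : Fin k) => y (some (.inr i)) / y none)
      {y | 0 < y none} :=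
  continuousOn_pi.2 fun _ => (continuous_apply _).continuousOn.div₀
    (continuous_apply _).continuousOn fun _ hy => (ne_of_gt hy)

/-- Strict inequalities give the open set needed for the lower bound. The index `l = 0` is exempt
because its entry repeats the site `s₀`. -/
lemma isOpen_strictMaxRatioSet {d k : ℕ} (L : Finset (Fin d → ℤ)) {O : Set (Fin k → ℝ≥0)}
    (hO : IsOpen O) : IsOpen (strictMaxRatioSet L O) := by
  have h0 : IsOpen {y : Option (L ⊕ Fin k) → ℝ≥0 | 0 < y none} :=
    isOpen_lt continuous_const (continuous_apply _)
  have h1 : IsOpen {y : Option (L ⊕ Fin k) → ℝ≥0 |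
      ∀ l : L, (l : Fin d → ℤ) ≠ 0 → y (some (.inl l)) < y none} := by
    simp only [ofPred_forall]
    exact isOpen_iInter_of_finite fun l => isOpen_iInter_of_finite fun _ =>
      isOpen_lt (continuous_apply _) (continuous_apply _)
  have h2 := (continuousOn_ratio L).isOpen_inter_preimage h0 hO
  convert h1.inter h2 using 1
  ext y
  simp only [strictMaxRatioSet, mem_ofPred_eq, mem_inter_iff, mem_preimage]
  tauto

/-- The condition `1 ≤ y none` defines a closed set on which the denominator stays away from `0`, so
the ratios are continuous there. -/
lemma isClosed_maxRatioSet {d k : ℕ} (L : Finset (Fin d → ℤ)) {C : Set (Fin k → ℝ≥0)}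
    (hC : IsClosed C) : IsClosed (maxRatioSet L C) := by
  have h0 : IsClosed {y : Option (L ⊕ Fin k) → ℝ≥0 | 1 ≤ y none} :=
    isClosed_le continuous_const (continuous_apply _)
  have h1 : IsClosed {y : Option (L ⊕ Fin k) → ℝ≥0 |
      ∀ l : L, y (some (.inl l)) ≤ y none} := by
    simp only [ofPred_forall]
    exact isClosed_iInter fun l => isClosed_le (continuous_apply _) (continuous_apply _)
  have h2 := ((continuousOn_ratio L).mono (ofPred_subset_ofPred.2 fun y hy =>
    one_pos.trans_le hy)).preimage_isClosed_of_isClosed h0 hC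
  convert h1.inter h2 using 1
  ext y
  simp only [maxRatioSet, mem_ofPred_eq, mem_inter_iff, mem_preimage]
  tauto

/-- The mass `∑ E F(-r)` of the shape function over the sites `r` outside `L`. -/
noncomputable def shapeTail {d : ℕ} {Ω : Type*} [MeasurableSpace Ω]
    (F : (Fin d → ℤ) → Ω → ℝ≥0) (P : Measure Ω) (L : Finset (Fin d → ℤ)) : ℝ≥0∞ :=
  ∑' r : {r // r ∉ L}, ∫⁻ ω, (F (-r) ω : ℝ≥0∞) ∂P

lemma contributionVector_apply {d : ℕ} {ι : Type*} (s : ι → Fin d → ℤ) {u : ℝ} (hu : 0 ≤ u)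
    (t : Fin d → ℤ) (f : (Fin d → ℤ) → ℝ≥0) (j : ι) :
    contributionVector s (u, t, f) j = u.toNNReal * f (s j - t) := by
  rw [contributionVector, contribution, Real.toNNReal_mul hu, Real.toNNReal_coe]

section

variable {d k : ℕ} {ΩF : Type*} [MeasurableSpace ΩF]
    {PF : Measure ΩF} {F : (Fin d → ℤ) → ΩF → ℝ≥0}

lemma shapeTail_ne_top (hsum : ∑' t, ∫⁻ ω, (F t ω : ℝ≥0∞) ∂PF = 1) (L : Finset (Fin d → ℤ)) :
    shapeTail F PF L ≠ ∞ := by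
  have h := (Equiv.neg (Fin d → ℤ)).tsum_eq fun t => ∫⁻ ω, (F t ω : ℝ≥0∞) ∂PF
  simp only [Equiv.neg_apply] at h
  refine ne_top_of_le_ne_top ?_ (ENNReal.tsum_comp_le_tsum_of_injective
    Subtype.val_injective fun r : Fin d → ℤ => ∫⁻ ω, (F (-r) ω : ℝ≥0∞) ∂PF)
  rw [h, hsum]
  exact ENNReal.one_ne_top

lemma tendsto_shapeTail (hsum : ∑' t, ∫⁻ ω, (F t ω : ℝ≥0∞) ∂PF = 1) :
    Tendsto (shapeTail F PF) atTop (𝓝 0) := by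
  have h := (Equiv.neg (Fin d → ℤ)).tsum_eq fun t => ∫⁻ ω, (F t ω : ℝ≥0∞) ∂PF
  simp only [Equiv.neg_apply] at h
  exact ENNReal.tendsto_tsum_compl_atTop_zero (by rw [h, hsum]; exact ENNReal.one_ne_top)

lemma exceedanceLaw_apply [SFinite PF] (hF : ∀ t, Measurable (F t)) {ι : Type*} [Countable ι]
    (s : ι → Fin d → ℤ) (s₀ : Fin d → ℤ) {U : Set (ι → ℝ≥0)} (hU : MeasurableSet U) :
    exceedanceLaw F PF s s₀ U = ∑' t, ∫⁻ ω, frechetIntensity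
      {u | contributionVector s (u, t, fun r => F r ω) ∈ U ∧ 1 < u * F (s₀ - t) ω} ∂PF := by
  rw [exceedanceLaw, Measure.map_apply (measurable_contributionVector s) hU,
    Measure.restrict_apply (measurable_contributionVector s hU), discreteM3Intensity_apply hF]
  · rfl
  · exact (measurable_contributionVector s hU).inter
      (measurableSet_lt measurable_const (measurable_contribution s₀))

lemma le_exceedanceLaw_strictMaxRatioSet [SFinite PF] (hF : ∀ t, Measurable (F t)) {lam : ℝ≥0}
    (hlam : 0 < lam) (hF0 : ∀ᵐ ω ∂PF, F 0 ω = lam) (hFlt : ∀ᵐ ω ∂PF, ∀ t, t ≠ 0 → F t ω < lam)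
    (s₀ : Fin d → ℤ) (L : Finset (Fin d → ℤ)) (τ : Fin k → Fin d → ℤ)
    {O : Set (Fin k → ℝ≥0)} (hO : IsOpen O) :
    lam * PF {ω | (fun i => F (τ i) ω / lam) ∈ O}
      ≤ exceedanceLaw F PF (siteFamily s₀ L τ) s₀ (strictMaxRatioSet L O) := by
  have hm : MeasurableSet {ω | (fun i => F (τ i) ω / lam) ∈ O} :=
    (measurable_pi_lambda _ fun i => (hF (τ i)).div_const lam) hO.measurableSet
  rw [exceedanceLaw_apply hF _ _ (isOpen_strictMaxRatioSet L hO).measurableSet]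
  -- Only the points located at `s₀` are kept: almost surely their contribution has a strict maximum
  -- at `s₀`, and their ratios are `F(τ i) / λ`.
  refine le_trans ?_ (ENNReal.le_tsum s₀)
  rw [← lintegral_indicator_const hm]
  refine lintegral_mono_ae ?_
  filter_upwards [hF0, hFlt] with ω h0 hlt
  by_cases hω : ω ∈ {ω | (fun i => F (τ i) ω / lam) ∈ O}
  · rw [indicator_of_mem hω]
    have h1 := frechetIntensity_lt_mul one_pos lam
    rw [ENNReal.ofReal_one, div_one] at h1
    rw [← h1]
    refine measure_mono (ofPred_subset_ofPred.2 fun u hu => ?_)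
    have hu0 : 0 < u := pos_of_mul_pos_left (one_pos.trans hu) lam.2
    have hu0' : 0 < u.toNNReal := Real.toNNReal_pos.2 hu0
    refine ⟨⟨?_, fun l hl => ?_, ?_⟩, by simpa [h0] using hu⟩
    · rw [contributionVector_apply _ hu0.le]
      simpa [siteFamily, h0] using ⟨hu0, hlam⟩
    · simp only [contributionVector_apply _ hu0.le, siteFamily, add_sub_cancel_left, sub_self, h0]
      exact mul_lt_mul_of_pos_left (hlt _ hl) hu0'
    · simp only [contributionVector_apply _ hu0.le, siteFamily, add_sub_cancel_left, sub_self, h0,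
        mul_div_mul_left _ _ hu0'.ne']
      exact hω
  · rw [indicator_of_notMem hω]
    exact zero_le

/-- The sum over locations `t` is compared term by term: `t = s₀` gives the main term, other `t ∈ s₀
+ L` give zero, and each `t` outside `s₀ + L` gives at most `E F(s₀ - t)`, with the ratio condition
dropped. -/
lemma exceedanceLaw_maxRatioSet_le [SFinite PF] (hF : ∀ t, Measurable (F t)) {lam : ℝ≥0}
    (hF0 : ∀ᵐ ω ∂PF, F 0 ω = lam) (hFlt : ∀ᵐ ω ∂PF, ∀ t, t ≠ 0 → F t ω < lam)
    (s₀ : Fin d → ℤ) {L : Finset (Fin d → ℤ)} (τ : Fin k → Fin d → ℤ)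
    {C : Set (Fin k → ℝ≥0)} (hC : IsClosed C) :
    exceedanceLaw F PF (siteFamily s₀ L τ) s₀ (maxRatioSet L C)
      ≤ lam * PF {ω | (fun i => F (τ i) ω / lam) ∈ C} + shapeTail F PF L := by
  classical
  have hm : MeasurableSet {ω | (fun i => F (τ i) ω / lam) ∈ C} :=
    (measurable_pi_lambda _ fun i => (hF (τ i)).div_const lam) hC.measurableSet
  have htail : shapeTail F PF L
      = ∑' t, if t - s₀ ∈ L then 0 else ∫⁻ ω, (F (s₀ - t) ω : ℝ≥0∞) ∂PF := by
    have h1 := tsum_subtype {r : Fin d → ℤ | r ∉ L} fun r => ∫⁻ ω, (F (-r) ω : ℝ≥0∞) ∂PF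
    have h2 := (Equiv.subRight s₀).tsum_eq ({r : Fin d → ℤ | r ∉ L}.indicator
      fun r => ∫⁻ ω, (F (-r) ω : ℝ≥0∞) ∂PF)
    refine (h1.trans h2.symm).trans (tsum_congr fun t => ?_)
    simp only [indicator_apply, Equiv.subRight_apply, mem_ofPred_eq, neg_sub, ite_not]
  rw [exceedanceLaw_apply hF _ _ (isClosed_maxRatioSet L hC).measurableSet, htail,
    ← tsum_ite_eq s₀ fun _ => (lam : ℝ≥0∞) * PF {ω | (fun i => F (τ i) ω / lam) ∈ C},
    ← ENNReal.tsum_add]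
  refine ENNReal.tsum_le_tsum fun t => ?_
  rcases eq_or_ne t s₀ with rfl | ht
  · rw [if_pos rfl]
    refine le_trans ?_ le_self_add
    rw [← lintegral_indicator_const hm]
    refine lintegral_mono_ae ?_
    filter_upwards [hF0] with ω h0
    by_cases hω : ω ∈ {ω | (fun i => F (τ i) ω / lam) ∈ C}
    · rw [indicator_of_mem hω]
      have h1 := frechetIntensity_lt_mul one_pos lam
      rw [ENNReal.ofReal_one, div_one] at h1
      rw [← h1]
      refine measure_mono (ofPred_subset_ofPred.2 fun u hu => ?_)
      simpa [h0] using hu.2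
    · refine le_of_eq_of_le (measure_mono_null ?_ measure_empty) zero_le
      rintro u ⟨⟨-, -, hu⟩, hu1⟩
      have hu0 : 0 < u := pos_of_mul_pos_left (one_pos.trans hu1) (F (t - t) ω).2
      have hu0' : 0 < u.toNNReal := Real.toNNReal_pos.2 hu0
      simp only [contributionVector_apply _ hu0.le, siteFamily, add_sub_cancel_left, sub_self, h0,
        mul_div_mul_left _ _ hu0'.ne'] at hu
      exact hω hu
  · rw [if_neg ht, zero_add]
    split_ifs with htL
    · refine le_of_eq (lintegral_eq_zero_of_ae_eq_zero ?_)
      filter_upwards [hF0, hFlt] with ω h0 hlt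
      refine measure_mono_null ?_ measure_empty
      rintro u ⟨⟨-, hu, -⟩, hu1⟩
      have hu0 : 0 < u := pos_of_mul_pos_left (one_pos.trans hu1) (F (s₀ - t) ω).2
      have hu0' : 0 < u.toNNReal := Real.toNNReal_pos.2 hu0
      -- Maximality at `s₀` is tested at the location `t` itself, where the contribution is `u λ`;
      -- this would force `λ ≤ F(s₀ - t)`.
      have hul := hu ⟨t - s₀, htL⟩
      simp only [contributionVector_apply _ hu0.le, siteFamily, add_sub_cancel, sub_self,
        h0] at hul
      exact absurd (le_of_mul_le_mul_left hul hu0') (not_le.2 (hlt _ (sub_ne_zero.2 ht.symm)))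
    · refine lintegral_mono fun ω => ?_
      have h1 := frechetIntensity_lt_mul one_pos (F (s₀ - t) ω)
      rw [ENNReal.ofReal_one, div_one] at h1
      rw [← h1]
      exact measure_mono (ofPred_subset_ofPred.2 fun u hu => hu.2)

end

/-! ### Transfer to `η` by the portmanteau theorem -/

/-- The positive parts of the ratios `η (s₀ + τ i) / η s₀`. -/
noncomputable def ratioVector {d k : ℕ} {Ω : Type*} (η : (Fin d → ℤ) → Ω → ℝ) (s₀ : Fin d → ℤ)
    (τ : Fin k → Fin d → ℤ) (ω : Ω) (i : Fin k) : ℝ≥0 :=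
  (η (s₀ + τ i) ω / η s₀ ω).toNNReal

section

variable {d k : ℕ} {Ω Ω' ΩF : Type*}
    [MeasurableSpace Ω] [MeasurableSpace Ω'] [MeasurableSpace ΩF]
    {P : Measure Ω} {P' : Measure Ω'} {PF : Measure ΩF}
    {F : (Fin d → ℤ) → ΩF → ℝ≥0}
    {X : ℕ → Ω' → ℝ × (Fin d → ℤ) × ((Fin d → ℤ) → ℝ≥0)}
    {η : (Fin d → ℤ) → Ω → ℝ}

lemma mem_localMaxEvent {Ω : Type*} {η : (Fin d → ℤ) → Ω → ℝ} {s₀ : Fin d → ℤ}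
    {L : Finset (Fin d → ℤ)} (hL : 0 ∈ L) {a : ℝ} {ω : Ω} :
    ω ∈ localMaxEvent η s₀ L a ↔ (∀ l ∈ L, η (s₀ + l) ω ≤ η s₀ ω) ∧ a ≤ η s₀ ω := by
  refine and_congr_left fun _ => ⟨fun h l hl => h.2 ⟨l, hl, rfl⟩, fun h => ⟨⟨0, hL, by simp⟩, ?_⟩⟩
  rintro _ ⟨l, hl, rfl⟩
  exact h l hl

lemma measurableSet_localMaxEvent (hη : ∀ t, Measurable (η t)) (s₀ : Fin d → ℤ)
    {L : Finset (Fin d → ℤ)} (hL : 0 ∈ L) (a : ℝ) : MeasurableSet (localMaxEvent η s₀ L a) := by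
  have : localMaxEvent η s₀ L a
      = (⋂ l ∈ L, {ω | η (s₀ + l) ω ≤ η s₀ ω}) ∩ {ω | a ≤ η s₀ ω} := by
    ext ω
    rw [mem_localMaxEvent hL]
    simp
  rw [this]
  exact (L.measurableSet_biInter fun l _ => measurableSet_le (hη _) (hη _)).inter
    (measurableSet_le measurable_const (hη _))

lemma conditionalLaw_apply (hη : ∀ t, Measurable (η t)) {ι : Type*} (s : ι → Fin d → ℤ)
    (s₀ : Fin d → ℤ) (a : ℝ) {U : Set (ι → ℝ≥0)} (hU : MeasurableSet U) :
    conditionalLaw η P s s₀ a U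
      = P ({ω | a < η s₀ ω} ∩ {ω | (fun j => (η (s j) ω / a).toNNReal) ∈ U})
        / P {ω | a < η s₀ ω} := by
  rw [conditionalLaw, Measure.map_apply (measurable_scaled hη s a) hU,
    cond_apply (measurableSet_lt measurable_const (hη s₀)), mul_comm, ← div_eq_mul_inv]
  rfl

lemma scaled_ratio {y z a : ℝ} (ha : 0 < a) (hz : 0 < z) :
    (y / a).toNNReal / (z / a).toNNReal = (y / z).toNNReal := by
  rw [← Real.toNNReal_div' (by positivity), div_div_div_cancel_right₀ ha.ne']

/-- The event `R` is left abstract so that one statement serves twice: with the ratio event for the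
numerator of the conditional probability, and with `O` and `R` the whole spaces for the denominator.
-/
lemma le_liminf_measure_localMaxEvent [IsProbabilityMeasure P]
    [IsProbabilityMeasure P'] [IsProbabilityMeasure PF] (hF : ∀ t, Measurable (F t))
    (hsum : ∑' t, ∫⁻ ω, (F t ω : ℝ≥0∞) ∂PF = 1) {lam : ℝ≥0} (hlam : 0 < lam)
    (hF0 : ∀ᵐ ω ∂PF, F 0 ω = lam) (hFlt : ∀ᵐ ω ∂PF, ∀ t, t ≠ 0 → F t ω < lam)
    (hX : IsPoissonPointProcess X (discreteM3Intensity F PF) P') (hη : ∀ t, Measurable (η t))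
    (hMDA : InMDA η P (discreteM3 X) P' (fun n _ => 1 / (n : ℝ)) (fun _ _ => 0))
    (s₀ : Fin d → ℤ) {L : Finset (Fin d → ℤ)} (hL : 0 ∈ L) (τ : Fin k → Fin d → ℤ)
    {O : Set (Fin k → ℝ≥0)} (hO : IsOpen O) {R : Set Ω}
    (hR : ∀ᵐ ω ∂P, ratioVector η s₀ τ ω ∈ O → ω ∈ R) {a : ℕ → ℝ} (ha : Tendsto a atTop atTop) :
    lam * PF {ω | (fun i => F (τ i) ω / lam) ∈ O} ≤ liminf (fun n =>
      P (localMaxEvent η s₀ L (a n) ∩ R) / P {ω | a n < η s₀ ω}) atTop := by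
  refine (le_exceedanceLaw_strictMaxRatioSet hF hlam hF0 hFlt s₀ L τ hO).trans ?_
  refine (ProbabilityMeasure.le_liminf_measure_open_of_tendsto
    ((tendsto_conditionalLaw hF hsum hX hη hMDA (siteFamily s₀ L τ) s₀).comp ha)
    (isOpen_strictMaxRatioSet L hO)).trans (liminf_le_liminf ?_)
  filter_upwards [ha.eventually_gt_atTop 0] with n hn
  refine (conditionalLaw_apply hη _ _ _ (isOpen_strictMaxRatioSet L hO).measurableSet).trans_le ?_
  refine ENNReal.div_le_div_right (measure_mono_ae ?_) _
  filter_upwards [hR] with ω hω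
  rintro ⟨h1, -, h2, h3⟩
  have h1' : a n < η s₀ ω := h1
  have h0 : 0 < η s₀ ω := hn.trans h1'
  refine ⟨(mem_localMaxEvent hL).2 ⟨fun l hl => ?_, h1'.le⟩, hω ?_⟩
  · rcases eq_or_ne l 0 with rfl | hl0
    · simp
    · have := (Real.toNNReal_lt_toNNReal_iff (by positivity)).1 (h2 ⟨l, hl⟩ hl0)
      exact ((div_lt_div_iff_of_pos_right hn).1 this).le
  · convert h3 using 1
    funext i
    exact (scaled_ratio hn h0).symm

lemma limsup_measure_localMaxEvent_le [IsProbabilityMeasure P]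
    [IsProbabilityMeasure P'] [IsProbabilityMeasure PF] (hF : ∀ t, Measurable (F t))
    (hsum : ∑' t, ∫⁻ ω, (F t ω : ℝ≥0∞) ∂PF = 1) {lam : ℝ≥0}
    (hF0 : ∀ᵐ ω ∂PF, F 0 ω = lam) (hFlt : ∀ᵐ ω ∂PF, ∀ t, t ≠ 0 → F t ω < lam)
    (hX : IsPoissonPointProcess X (discreteM3Intensity F PF) P') (hη : ∀ t, Measurable (η t))
    (hMDA : InMDA η P (discreteM3 X) P' (fun n _ => 1 / (n : ℝ)) (fun _ _ => 0))
    (s₀ : Fin d → ℤ) {L : Finset (Fin d → ℤ)} (hL : 0 ∈ L) (τ : Fin k → Fin d → ℤ)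
    {C : Set (Fin k → ℝ≥0)} (hC : IsClosed C) {R : Set Ω}
    (hR : ∀ᵐ ω ∂P, ω ∈ R → ratioVector η s₀ τ ω ∈ C) {a : ℕ → ℝ} (ha : Tendsto a atTop atTop) :
    limsup (fun n => P (localMaxEvent η s₀ L (a n) ∩ R) / P {ω | a n < η s₀ ω}) atTop
      ≤ lam * PF {ω | (fun i => F (τ i) ω / lam) ∈ C} + shapeTail F PF L := by
  refine le_trans ?_ (exceedanceLaw_maxRatioSet_le hF hF0 hFlt s₀ τ hC)
  -- The local maximum event allows `η s₀ = a n`, which the conditioning excludes; this tie is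
  -- negligible.
  have htie : Tendsto (fun n => P {ω | η s₀ ω = a n} / P {ω | a n < η s₀ ω}) atTop (𝓝 0) := by
    have h1 := (tendsto_mul_measureReal_eq hF hsum hX hη hMDA s₀).div
      (tendsto_mul_measureReal_lt hF hsum hX hη hMDA s₀ one_pos) (by norm_num)
    have h2 := ENNReal.tendsto_ofReal (h1.comp ha)
    rw [zero_div, ENNReal.ofReal_zero] at h2
    refine h2.congr' ?_
    filter_upwards [ha.eventually_gt_atTop 0] with n hn
    simp only [Function.comp_apply, Pi.div_apply, mul_one]
    have h3 := measure_lt_ne_zero hF hsum hX hη hMDA s₀ (a n)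
    rw [mul_div_mul_left _ _ hn.ne', measureReal_def P {ω | a n < η s₀ ω},
      ENNReal.ofReal_div_of_pos (ENNReal.toReal_pos h3 (measure_ne_top _ _)),
      ofReal_measureReal,
      ENNReal.ofReal_toReal (measure_ne_top _ _)]
  have hbound : ∀ᶠ n in atTop, P (localMaxEvent η s₀ L (a n) ∩ R) / P {ω | a n < η s₀ ω}
      ≤ conditionalLaw η P (siteFamily s₀ L τ) s₀ (a n) (maxRatioSet L C)
        + P {ω | η s₀ ω = a n} / P {ω | a n < η s₀ ω} := by
    filter_upwards [ha.eventually_gt_atTop 0] with n hn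
    rw [conditionalLaw_apply hη _ _ _ (isClosed_maxRatioSet L hC).measurableSet,
      ENNReal.div_add_div_same]
    refine ENNReal.div_le_div_right (le_trans (measure_mono_ae ?_) (measure_union_le _ _)) _
    filter_upwards [hR] with ω hω
    rintro ⟨h1, h2⟩
    obtain ⟨h3, h4⟩ := (mem_localMaxEvent hL).1 h1
    rcases h4.eq_or_lt with h5 | h5
    · exact .inr h5.symm
    · have h0 : 0 < η s₀ ω := hn.trans h5
      refine .inl ⟨h5, ?_, fun l => ?_, ?_⟩
      · exact Real.one_le_toNNReal.2 ((one_le_div hn).2 h5.le)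
      · exact Real.toNNReal_le_toNNReal (div_le_div_of_nonneg_right (h3 l l.2) hn.le)
      · convert hω h2 using 1
        funext i
        exact scaled_ratio hn h0
  refine (limsup_le_limsup hbound).trans ?_
  refine (ENNReal.limsup_add_of_right_tendsto_zero htie _).trans_le ?_
  exact ProbabilityMeasure.limsup_measure_closed_le_of_tendsto
    ((tendsto_conditionalLaw hF hsum hX hη hMDA (siteFamily s₀ L τ) s₀).comp ha)
    (isClosed_maxRatioSet L hC)

/-- If the boundary of `B₁ × ⋯ × B_k` is not charged by the limit law, the ratio event can be
squeezed between an open and a closed condition on the positive parts of the ratios. -/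
lemma exists_open_closed_ratioEvent (s₀ : Fin d → ℤ) (τ : Fin k → Fin d → ℤ) (B : Fin k → Set ℝ≥0)
    (lam : ℝ≥0)
    (hfr : PF {ω | (fun i : Fin k => ((F (τ i) ω / lam : ℝ≥0) : ℝ)) ∈
          frontier (univ.pi fun i => ((↑) : ℝ≥0 → ℝ) '' B i)} = 0 ∨
        ((∀ s, ∀ᵐ ω ∂P, 0 ≤ η s ω) ∧
          PF {ω | (fun i : Fin k => F (τ i) ω / lam) ∈ frontier (univ.pi B)} = 0)) :
    ∃ O C : Set (Fin k → ℝ≥0), IsOpen O ∧ IsClosed C ∧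
      (∀ᵐ ω ∂P, ratioVector η s₀ τ ω ∈ O → ω ∈ ratioEvent η s₀ τ B) ∧
      (∀ᵐ ω ∂P, ω ∈ ratioEvent η s₀ τ B → ratioVector η s₀ τ ω ∈ C) ∧
      PF {ω | (fun i => F (τ i) ω / lam) ∈ O} = PF {ω | ∀ i, F (τ i) ω / lam ∈ B i} ∧
      PF {ω | (fun i => F (τ i) ω / lam) ∈ C} = PF {ω | ∀ i, F (τ i) ω / lam ∈ B i} := by
  have hclosed : ∀ ω, ω ∈ ratioEvent η s₀ τ B → ratioVector η s₀ τ ω ∈ closure (univ.pi B) := by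
    intro ω hω
    refine subset_closure fun i _ => ?_
    obtain ⟨b, hb, hbe⟩ := hω i
    rw [ratioVector, ← hbe, Real.toNNReal_coe]
    exact hb
  -- The closed set is the closure of the product in both cases; only the choice of the open set `O`
  -- depends on where the boundary is taken.
  have hmass : ∀ O : Set (Fin k → ℝ≥0), O ⊆ univ.pi B →
      PF {ω | (fun i => F (τ i) ω / lam) ∈ closure (univ.pi B) \ O} = 0 →
      PF {ω | (fun i => F (τ i) ω / lam) ∈ O} = PF {ω | ∀ i, F (τ i) ω / lam ∈ B i} ∧
      PF {ω | (fun i => F (τ i) ω / lam) ∈ closure (univ.pi B)}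
        = PF {ω | ∀ i, F (τ i) ω / lam ∈ B i} := by
    intro O hOB hnull
    have hae : ∀ᵐ ω ∂PF, ¬ (fun i => F (τ i) ω / lam) ∈ closure (univ.pi B) \ O := by
      rw [ae_iff]; simpa using hnull
    have hsub : ∀ ω, (∀ i, F (τ i) ω / lam ∈ B i) →
        (fun i => F (τ i) ω / lam) ∈ closure (univ.pi B) := fun ω h =>
      subset_closure fun i _ => h i
    constructor
    · refine measure_congr ?_
      filter_upwards [hae] with ω hω
      refine propext ⟨fun h i => hOB h i (mem_univ i), fun h => ?_⟩
      by_contra hcon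
      exact hω ⟨hsub ω h, hcon⟩
    · refine measure_congr ?_
      filter_upwards [hae] with ω hω
      refine propext ⟨fun h i => ?_, fun h => hsub ω h⟩
      by_contra hcon
      exact hω ⟨h, fun hO => hcon (hOB hO i (mem_univ i))⟩
  rcases hfr with hfr | ⟨hnn, hfr⟩
  · have hcoe : Continuous fun (x : Fin k → ℝ≥0) i => ((x i : ℝ≥0) : ℝ) := by fun_prop
    -- Positive parts could hide negative ratios. Interior points in `ℝ^k` have positive
    -- coordinates, so a positive part lying there equals the ratio itself. In the other case below,
    -- nonnegativity of `η` plays this role.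
    have hpos : ∀ z ∈ interior (univ.pi fun i => ((↑) : ℝ≥0 → ℝ) '' B i), ∀ i, 0 < z i := by
      intro z hz i
      rw [interior_pi_set finite_univ] at hz
      have h1 : ((↑) : ℝ≥0 → ℝ) '' B i ⊆ Ici 0 := by
        rintro _ ⟨b, -, rfl⟩
        exact b.2
      have h2 := interior_mono h1 (hz i (mem_univ i))
      rwa [interior_Ici] at h2
    have hOB : (fun (x : Fin k → ℝ≥0) i => ((x i : ℝ≥0) : ℝ)) ⁻¹'
        interior (univ.pi fun i => ((↑) : ℝ≥0 → ℝ) '' B i) ⊆ univ.pi B := by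
      intro x hx i _
      obtain ⟨b, hb, hbe⟩ := interior_subset hx i (mem_univ i)
      rwa [← NNReal.coe_injective hbe]
    obtain ⟨h1, h2⟩ := hmass _ hOB (by
      refine measure_mono_null (ofPred_subset_ofPred.2 fun ω hω => ⟨?_, hω.2⟩) hfr
      exact map_mem_closure hcoe hω.1 fun x hx i _ => ⟨x i, hx i (mem_univ i), rfl⟩)
    refine ⟨_, _, isOpen_interior.preimage hcoe, isClosed_closure, ae_of_all _ fun ω hω i => ?_,
      ae_of_all _ hclosed, h1, h2⟩
    have hi := hpos _ hω i
    have h3 := interior_subset hω i (mem_univ i)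
    have h4 : 0 < η (s₀ + τ i) ω / η s₀ ω := Real.toNNReal_pos.1 (NNReal.coe_pos.1 hi)
    simpa only [ratioVector, Real.coe_toNNReal _ h4.le] using h3
  · obtain ⟨h1, h2⟩ := hmass (interior (univ.pi B)) interior_subset hfr
    refine ⟨_, _, isOpen_interior, isClosed_closure, ?_, ae_of_all _ hclosed, h1, h2⟩
    filter_upwards [hnn s₀, ae_all_iff.2 fun i => hnn (s₀ + τ i)] with ω h0 hi hω i
    exact ⟨_, interior_subset hω i (mem_univ i), Real.coe_toNNReal _ (div_nonneg (hi i) h0)⟩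

end

/-! ### Conclusion -/

theorem mainTheorem8 {d : ℕ} {Ω Ω' ΩF : Type*}
    [MeasurableSpace Ω] [MeasurableSpace Ω'] [MeasurableSpace ΩF]
    (P : Measure Ω) [IsProbabilityMeasure P] (P' : Measure Ω') [IsProbabilityMeasure P']
    (PF : Measure ΩF) [IsProbabilityMeasure PF]
    -- the shape function `F`
    (F : (Fin d → ℤ) → ΩF → ℝ≥0) (hF : ∀ t, Measurable (F t))
    (hFsum : ∑' t, ∫⁻ ω, (F t ω : ℝ≥0∞) ∂PF = 1)
    (lam : ℝ≥0) (hlam : 0 < lam)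
    (hF0 : ∀ᵐ ω ∂PF, F 0 ω = lam) (hFlt : ∀ᵐ ω ∂PF, ∀ t, t ≠ 0 → F t ω < lam)
    -- the Poisson points `X i = (U_i, T_i, F_i)`
    (X : ℕ → Ω' → ℝ × (Fin d → ℤ) × ((Fin d → ℤ) → ℝ≥0))
    (hX : IsPoissonPointProcess X (discreteM3Intensity F PF) P')
    -- the process `η` in the max-domain of attraction of the mixed moving maxima process
    (η : (Fin d → ℤ) → Ω → ℝ) (hη : ∀ t, Measurable (η t))
    (hMDA : InMDA η P (discreteM3 X) P' (fun n _ => 1 / (n : ℝ)) (fun _ _ => 0))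
    -- `k + 1` distinct points and Borel sets `B_i ⊆ [0, ∞)`
    (k : ℕ) (t : Fin (k + 1) → Fin d → ℤ) (ht : Function.Injective t)
    (B : Fin k → Set ℝ≥0) (hB : ∀ i, MeasurableSet (B i))
    -- the boundary is taken in `ℝ^k` or, if `η` is nonnegative, in `[0, ∞)^k`
    (hfr : PF {ω | (fun i : Fin k => ((F (t i.succ) ω / lam : ℝ≥0) : ℝ)) ∈
          frontier (univ.pi fun i => ((↑) : ℝ≥0 → ℝ) '' B i)} = 0 ∨
        ((∀ s, ∀ᵐ ω ∂P, 0 ≤ η s ω) ∧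
          PF {ω | (fun i : Fin k => F (t i.succ) ω / lam) ∈ frontier (univ.pi B)} = 0))
    (a : ℕ → ℝ) (ha : Tendsto a atTop atTop) :
    (∀ L : Finset (Fin d → ℤ), 0 ∈ L →
      ∀ᶠ n in atTop, 0 < P (localMaxEvent η (t 0) L (a n))) ∧
    Tendsto (fun L : Finset (Fin d → ℤ) =>
        limsup (fun n => P[ratioEvent η (t 0) (fun i => t i.succ) B |
          localMaxEvent η (t 0) L (a n)]) atTop) atTop
      (𝓝 (PF {ω | ∀ i : Fin k, F (t i.succ) ω / lam ∈ B i})) ∧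
    Tendsto (fun L : Finset (Fin d → ℤ) =>
        liminf (fun n => P[ratioEvent η (t 0) (fun i => t i.succ) B |
          localMaxEvent η (t 0) L (a n)]) atTop) atTop
      (𝓝 (PF {ω | ∀ i : Fin k, F (t i.succ) ω / lam ∈ B i})) := by
  set τ : Fin k → Fin d → ℤ := fun i => t i.succ
  set R := ratioEvent η (t 0) τ B
  set p := PF {ω | ∀ i : Fin k, F (τ i) ω / lam ∈ B i} with hp
  obtain ⟨O, C, hO, hC, hOR, hRC, hpO, hpC⟩ :=
    exists_open_closed_ratioEvent (PF := PF) (F := F) (P := P) (η := η) (t 0) τ B lam hfr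
  have hlam0 : (lam : ℝ≥0∞) ≠ 0 := by exact_mod_cast hlam.ne'
  have hp_top : p ≠ ∞ := measure_ne_top _ _
  have hG := measure_lt_ne_zero hF hFsum hX hη hMDA (t 0)
  have lower : ∀ L : Finset (Fin d → ℤ), 0 ∈ L → lam ≤ liminf (fun n =>
      P (localMaxEvent η (t 0) L (a n)) / P {ω | a n < η (t 0) ω}) atTop := by
    intro L hL
    simpa using le_liminf_measure_localMaxEvent hF hFsum hlam hF0 hFlt hX hη hMDA (t 0) hL τ
      isOpen_univ (R := univ) (by simp) ha
  have upper : ∀ L : Finset (Fin d → ℤ), 0 ∈ L → limsup (fun n =>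
      P (localMaxEvent η (t 0) L (a n)) / P {ω | a n < η (t 0) ω}) atTop
        ≤ lam + shapeTail F PF L := by
    intro L hL
    simpa using limsup_measure_localMaxEvent_le hF hFsum hF0 hFlt hX hη hMDA (t 0) hL τ
      isClosed_univ (R := univ) (by simp) ha
  -- Numerator and denominator of the conditional probability are both divided by `P(η(t 0) > a n)`,
  -- the normalisation in which each has asymptotic bounds.
  have hcond : ∀ L : Finset (Fin d → ℤ), 0 ∈ L →
      (fun n => P[R | localMaxEvent η (t 0) L (a n)])
        = (fun n => P (localMaxEvent η (t 0) L (a n) ∩ R) / P {ω | a n < η (t 0) ω}) *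
          fun n => (P (localMaxEvent η (t 0) L (a n)) / P {ω | a n < η (t 0) ω})⁻¹ := by
    intro L hL
    funext n
    rw [cond_apply (measurableSet_localMaxEvent hη _ hL _), Pi.mul_apply,
      ENNReal.inv_div (.inl (measure_ne_top _ _)) (.inl (hG _)),
      div_eq_mul_inv, div_eq_mul_inv, mul_assoc, ← mul_assoc (P {ω | a n < η (t 0) ω})⁻¹,
      ENNReal.inv_mul_cancel (hG _) (measure_ne_top _ _), one_mul, mul_comm]
  have hup : ∀ L : Finset (Fin d → ℤ), 0 ∈ L →
      limsup (fun n => P[R | localMaxEvent η (t 0) L (a n)]) atTop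
        ≤ (lam * p + shapeTail F PF L) * (lam : ℝ≥0∞)⁻¹ := by
    intro L hL
    have h1 := limsup_measure_localMaxEvent_le hF hFsum hF0 hFlt hX hη hMDA (t 0) hL τ hC hRC ha
    rw [hpC] at h1
    have h2 : limsup (fun n =>
        (P (localMaxEvent η (t 0) L (a n)) / P {ω | a n < η (t 0) ω})⁻¹) atTop
          ≤ (lam : ℝ≥0∞)⁻¹ := by
      rw [← ENNReal.inv_liminf]
      exact ENNReal.inv_le_inv.2 (lower L hL)
    rw [hcond L hL]
    refine (ENNReal.limsup_mul_le' (.inr ?_) (.inl ?_)).trans (mul_le_mul' h1 h2)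
    · exact ne_top_of_le_ne_top (ENNReal.inv_ne_top.2 hlam0) h2
    · exact ne_top_of_le_ne_top (ENNReal.add_ne_top.2
        ⟨ENNReal.mul_ne_top ENNReal.coe_ne_top hp_top, shapeTail_ne_top hFsum L⟩) h1
  have hlo : ∀ L : Finset (Fin d → ℤ), 0 ∈ L →
      lam * p * (lam + shapeTail F PF L)⁻¹
        ≤ liminf (fun n => P[R | localMaxEvent η (t 0) L (a n)]) atTop := by
    intro L hL
    have h1 := le_liminf_measure_localMaxEvent hF hFsum hlam hF0 hFlt hX hη hMDA (t 0) hL τ hO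
      hOR ha
    rw [hpO] at h1
    rw [hcond L hL]
    refine (mul_le_mul' h1 ?_).trans ENNReal.le_liminf_mul
    rw [← ENNReal.inv_limsup]
    exact ENNReal.inv_le_inv.2 (upper L hL)
  have htail := tendsto_shapeTail (F := F) (PF := PF) hFsum
  have hcancel : lam * p * (lam : ℝ≥0∞)⁻¹ = p := by
    rw [mul_comm, ← mul_assoc, ENNReal.inv_mul_cancel hlam0 ENNReal.coe_ne_top, one_mul]
  have hupT : Tendsto (fun L => (lam * p + shapeTail F PF L) * (lam : ℝ≥0∞)⁻¹) atTop (𝓝 p) := by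
    have h1 := ENNReal.Tendsto.mul_const (htail.const_add (lam * p)) (b := (lam : ℝ≥0∞)⁻¹)
      (.inr (ENNReal.inv_ne_top.2 hlam0))
    rwa [add_zero, hcancel] at h1
  have hloT : Tendsto (fun L => lam * p * (lam + shapeTail F PF L)⁻¹) atTop (𝓝 p) := by
    have h1 := ENNReal.Tendsto.const_mul (a := lam * p)
      (tendsto_inv_iff.2 (htail.const_add (lam : ℝ≥0∞)))
      (.inr (ENNReal.mul_ne_top ENNReal.coe_ne_top hp_top))
    rwa [add_zero, hcancel] at h1
  have hev : ∀ᶠ L : Finset (Fin d → ℤ) in atTop, 0 ∈ L := by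
    filter_upwards [eventually_ge_atTop {0}] with L hL using hL (Finset.mem_singleton_self 0)
  refine ⟨fun L hL => ?_, ?_, ?_⟩
  -- Positivity of the event follows from the lower bound `λ > 0` on the normalised liminf.
  · have h1 := eventually_lt_of_lt_liminf ((pos_iff_ne_zero.2 hlam0).trans_le (lower L hL))
    filter_upwards [h1] with n hn
    exact pos_iff_ne_zero.2 fun h0 => by simp [h0] at hn
  · refine tendsto_of_tendsto_of_tendsto_of_le_of_le' hloT hupT ?_ ?_
    · filter_upwards [hev] with L hL using (hlo L hL).trans liminf_le_limsup
    · filter_upwards [hev] with L hL using hup L hL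
  · refine tendsto_of_tendsto_of_tendsto_of_le_of_le' hloT hupT ?_ ?_
    · filter_upwards [hev] with L hL using hlo L hL
    · filter_upwards [hev] with L hL using le_trans liminf_le_limsup (hup L hL)
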